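/- Let $\ell,h_1,h_2\in\mathbb C$ and let $\mathcal S$ be the smooth projective model of the curve $$\eta^3-\ell^2\eta-729\lambda^5+162h_1\lambda^3-9h_2\lambda=0 ,$$ with its single point at infinity $\infty$ and the involution $\upsilon:(\lambda,\eta)\mapsto(-\lambda,-\eta)$. Write $\equiv$ for linear equivalence of divisors on $\mathcal S$, $\mathrm{Jac}(\mathcal S)=\mathrm{Pic}^0(\mathcal S)$, and $\mathrm{Prym}(\mathcal S,\upsilon)=(1-\upsilon)\,\mathrm{Jac}(\mathcal S)$. For $x=(q_1,q_2,p_1,p_2)\in\mathbb C^4$ with $q_2\ne0$ put $$L_x(\lambda)=\begin{pmatrix}6\lambda q_1&-\tfrac12(3q_1^2+q_2^2)&9\lambda-3p_1\\ 9\lambda^2+3\lambda p_1&-3\lambda q_1-q_2p_2&q_2^2\\ -\tfrac12\lambda(3q_1^2+q_2^2)&9\lambda^2+\frac{\ell^2}{q_2^2}-p_2^2&q_2p_2-3\lambda q_1\end{pmatrix},$$ $$H_1=\tfrac12(p_1^2+p_2^2)+\tfrac16q_1^3+\tfrac12q_1q_2^2-\frac{\ell^2}{2q_2^2},\qquad H_2=\Bigl(p_1p_2+\tfrac12q_1^2q_2+\tfrac16q_2^3\Bigr)^2-\ell^2\Bigl(\frac{p_1^2}{q_2^2}+\tfrac23q_1\Bigr).$$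 Let $\mu\in\mathbb C$ be such that there are three distinct points $Q_i=(\mu,\eta_i)$, $i=1,2,3$, of the affine curve over $\lambda=\mu$, and let $\{\alpha,\beta,\gamma\}=\{1,2,3\}$. The branch of the Bäcklund map $\mathcal B$ fixed by $Q_\alpha=(\mu,\eta^*)$, $\eta^*=\eta_\alpha$, relates $x$ to $\tilde x$ if there are $Y_1,Y_2\in\mathbb C$ such that $L_x(\mu)(1,Y_1,Y_2)^T=\eta^*(1,Y_1,Y_2)^T$ and $L_{\tilde x}(\lambda)M(\lambda|\mu)=M(\lambda|\mu)L_x(\lambda)$ for all $\lambda\in\mathbb C$, where $$M(\lambda|\mu)=\begin{pmatrix}\mu-\lambda&-2Y_2&2Y_1\\ 2Y_1\lambda&2Y_1Y_2-\lambda-\mu&-2Y_1^2\\ 2(Y_2-2Y_1^2)\lambda&2Y_2(Y_2-2Y_1^2)+2Y_1(\lambda+\mu)&-2Y_1(Y_2-2Y_1^2)-\lambda-\mu\end{pmatrix}.$$ Let $H_1(x)=h_1$, $H_2(x)=h_2$, and let $\tilde x$ be the image of $x$ under this branch. Let $\psi,\widetilde\psi$ be any non-zero vectors of rational functions on $\mathcal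 S$ with $L_x(\lambda)\psi=\eta\psi$ and $L_{\tilde x}(\lambda)\widetilde\psi=\eta\widetilde\psi$, and let $\mathcal D=\sum_P\max_i(-\mathrm{ord}_P\psi_i)\,P$ and $\widetilde{\mathcal D}=\sum_P\max_i(-\mathrm{ord}_P\widetilde\psi_i)\,P$ be their pole divisors. Then: 1) $\widetilde{\mathcal D}+Q_\alpha+\upsilon(Q_\beta)+\upsilon(Q_\gamma)\equiv\mathcal D+3\infty$. 2) The shift divisor satisfies $$\widetilde{\mathcal D}-\mathcal D\equiv 3\infty-Q_\alpha-\upsilon(Q_\beta)-\upsilon(Q_\gamma)\equiv\upsilon(Q_\alpha)-Q_\alpha ,$$ and its class lies in $\mathrm{Prym}(\mathcal S,\upsilon)$. Hence this branch of $\mathcal B$ acts on the divisor classes as the translation by one point of $\mathrm{Prym}(\mathcal S,\upsilon)$, the same for all $x$ on the level set $H_1=h_1$, $H_2=h_2$. -/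

import Mathlib

open Polynomial WithZero

namespace HenonHeiles

noncomputable section

/-! ### Points, divisors and the Picard group of a curve, through its function field -/

section Curve

variable (F : Type*) [Field F] [Algebra ℂ F]

/-- A place of `F / ℂ`: a normalized discrete valuation of `F` that is trivial on `ℂ`, written
multiplicatively, so that `v f = exp (-ord f)`. When `F` is the function field of a complex
algebraic curve, these are the points of its smooth projective model. -/
@[ext]
structure Place where
  v : Valuation F ℤᵐ⁰
  surjective : Function.Surjective v
  trivial_on_const : ∀ c : ℂ, c ≠ 0 → v (algebraMap ℂ F c) = 1

/-- Divisors on the smooth projective curve with function field `F`. -/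
abbrev Divisor : Type _ := Place F →₀ ℤ

variable {F}

/-- The divisor consisting of one point. -/
def pt (P : Place F) : Divisor F := Finsupp.single P 1

variable (F) in
/-- The degree of a divisor (all points have degree one over `ℂ`). -/
def degree : Divisor F →+ ℤ := Finsupp.liftAddHom fun _ => AddMonoidHom.id ℤ

variable (F) in
/-- The group of principal divisors `(f) = ∑ ord_P(f) P`, `f ≠ 0`. -/
def principal : AddSubgroup (Divisor F) where
  carrier := {D | ∃ f : F, f ≠ 0 ∧ ∀ P : Place F, P.v f = exp (-(D P))}
  zero_mem' := ⟨1, one_ne_zero, fun P => by simp⟩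
  add_mem' := by
    rintro D E ⟨f, hf, hD⟩ ⟨g, hg, hE⟩
    refine ⟨f * g, mul_ne_zero hf hg, fun P => ?_⟩
    rw [map_mul, hD, hE, ← exp_add, Finsupp.add_apply, neg_add]
  neg_mem' := by
    rintro D ⟨f, hf, hD⟩
    refine ⟨f⁻¹, inv_ne_zero hf, fun P => ?_⟩
    rw [map_inv₀, hD, ← exp_neg, Finsupp.neg_apply]

/-- Linear equivalence of divisors. -/
def LinEquiv (D E : Divisor F) : Prop := D - E ∈ principal F

variable (F) in
/-- The Picard group: divisors modulo linear equivalence. -/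
abbrev Pic : Type _ := Divisor F ⧸ principal F

/-- The class of a divisor. -/
def cls (D : Divisor F) : Pic F := QuotientAddGroup.mk D

variable (F) in
/-- The Jacobian, as the subgroup `Pic⁰` of classes of divisors of degree zero. -/
def Jac : AddSubgroup (Pic F) :=
  (degree F).ker.map (QuotientAddGroup.mk' (principal F))

/-- The action on points of an automorphism of the curve, given by its pull-back `s` on
functions: `ord_{s(P)} f = ord_P (s f)`. -/
def Place.map (s : F ≃ₐ[ℂ] F) (P : Place F) : Place F where
  v := P.v.comap (s : F →+* F)
  surjective := fun y => by
    obtain ⟨x, hx⟩ := P.surjective y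
    exact ⟨s.symm x, by simpa using hx⟩
  trivial_on_const := fun c hc => by
    simpa using P.trivial_on_const c hc

/-- The action of an automorphism of the curve on divisors. -/
def divMap (s : F ≃ₐ[ℂ] F) : Divisor F →+ Divisor F :=
  Finsupp.mapDomain.addMonoidHom (Place.map s)

theorem Place.map_map_symm (s : F ≃ₐ[ℂ] F) (P : Place F) :
    Place.map s (Place.map s.symm P) = P := by
  ext f; simp [Place.map]

theorem Place.map_symm_map (s : F ≃ₐ[ℂ] F) (P : Place F) :
    Place.map s.symm (Place.map s P) = P := by
  ext f; simp [Place.map]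

theorem divMap_apply (s : F ≃ₐ[ℂ] F) (D : Divisor F) (P : Place F) :
    divMap s D P = D (Place.map s.symm P) := by
  have hinj : Function.Injective (Place.map s) :=
    Function.LeftInverse.injective (Place.map_symm_map s)
  have h := Finsupp.mapDomain_apply hinj D (Place.map s.symm P)
  rwa [Place.map_map_symm] at h

theorem principal_le_comap (s : F ≃ₐ[ℂ] F) :
    principal F ≤ (principal F).comap (divMap s) := by
  rintro D ⟨f, hf, hD⟩
  refine ⟨s.symm f, by simpa using hf, fun P => ?_⟩
  rw [divMap_apply, ← hD]
  simp [Place.map]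

/-- The action of an automorphism of the curve on divisor classes. -/
def picMap (s : F ≃ₐ[ℂ] F) : Pic F →+ Pic F :=
  QuotientAddGroup.map (principal F) (principal F) (divMap s) (principal_le_comap s)

/-- The Prym variety of a curve with an involution `s`: the image of `1 - s` on the Jacobian. -/
def Prym (s : F ≃ₐ[ℂ] F) : AddSubgroup (Pic F) :=
  (Jac F).map (AddMonoidHom.id (Pic F) - picMap s)

/-- `D` is the divisor of poles of the projective vector `ψ`: the multiplicity of `D` at `P` is
`max_i (-ord_P ψ_i)`. -/
def IsPoleDivisor (ψ : Fin 3 → F) (D : Divisor F) : Prop :=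
  ∀ P : Place F, P.v (ψ 0) ⊔ P.v (ψ 1) ⊔ P.v (ψ 2) = exp (D P)

end Curve

/-! ### The Hénon--Heiles system -/

/-- Points `(q₁, q₂, p₁, p₂)` of the complexified phase space, where `q₂ ≠ 0`. -/
structure Phase where
  q₁ : ℂ
  q₂ : ℂ
  p₁ : ℂ
  p₂ : ℂ
  q₂_ne_zero : q₂ ≠ 0

/-- The Hamiltonian. -/
def H₁ (l : ℂ) (x : Phase) : ℂ :=
  (x.p₁ ^ 2 + x.p₂ ^ 2) / 2 + x.q₁ ^ 3 / 6 + x.q₁ * x.q₂ ^ 2 / 2 - l ^ 2 / (2 * x.q₂ ^ 2)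

/-- The additional integral. -/
def H₂ (l : ℂ) (x : Phase) : ℂ :=
  (x.p₁ * x.p₂ + x.q₁ ^ 2 * x.q₂ / 2 + x.q₂ ^ 3 / 6) ^ 2
    - l ^ 2 * (x.p₁ ^ 2 / x.q₂ ^ 2 + 2 / 3 * x.q₁)

section Lax

variable {R : Type*} [CommRing R] [Algebra ℂ R]

/-- The Lax matrix `L(t)`, for a spectral parameter `t` in any `ℂ`-algebra. -/
def laxL (l : ℂ) (x : Phase) (t : R) : Matrix (Fin 3) (Fin 3) R :=
  let c : ℂ → R := algebraMap ℂ R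
  !![6 * t * c x.q₁, -c ((3 * x.q₁ ^ 2 + x.q₂ ^ 2) / 2), 9 * t - 3 * c x.p₁;
     9 * t ^ 2 + 3 * t * c x.p₁, -3 * t * c x.q₁ - c (x.q₂ * x.p₂), c (x.q₂ ^ 2);
     -t * c ((3 * x.q₁ ^ 2 + x.q₂ ^ 2) / 2), 9 * t ^ 2 + c (l ^ 2 / x.q₂ ^ 2 - x.p₂ ^ 2),
       c (x.q₂ * x.p₂) - 3 * t * c x.q₁]

end Lax

/-- The intertwining matrix `M(t | μ)` with parameters `Y₁, Y₂`. -/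
def matM (μ Y₁ Y₂ t : ℂ) : Matrix (Fin 3) (Fin 3) ℂ :=
  !![μ - t, -2 * Y₂, 2 * Y₁;
     2 * Y₁ * t, 2 * Y₁ * Y₂ - t - μ, -2 * Y₁ ^ 2;
     2 * (Y₂ - 2 * Y₁ ^ 2) * t, 2 * Y₂ * (Y₂ - 2 * Y₁ ^ 2) + 2 * Y₁ * (t + μ),
       -2 * Y₁ * (Y₂ - 2 * Y₁ ^ 2) - t - μ]

/-- `x'` is the image of `x` under the branch of the Bäcklund transformation with parameter `μ`
that is fixed by the eigenvalue `e` of `L(μ)`: `Y₁, Y₂` are given by the eigenvector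
`(1, Y₁, Y₂)` of `L(μ)` for `e`, and `L'(t) M(t | μ) = M(t | μ) L(t)` identically in `t`. -/
def IsBacklundImage (l μ e : ℂ) (x x' : Phase) : Prop :=
  ∃ Y₁ Y₂ : ℂ,
    (laxL l x μ).mulVec ![1, Y₁, Y₂] = e • ![1, Y₁, Y₂] ∧
    ∀ t : ℂ, laxL l x' t * matM μ Y₁ Y₂ t = matM μ Y₁ Y₂ t * laxL l x t

/-! ### The spectral curve -/

/-- The right-hand side of the equation `η³ - l² η = 729 λ⁵ - 162 h₁ λ³ + 9 h₂ λ`. -/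
def rhs (h₁ h₂ : ℂ) : ℂ[X] := C 729 * X ^ 5 - C (162 * h₁) * X ^ 3 + C (9 * h₂) * X

/-- The equation of the spectral curve, as a polynomial in `η` over `ℂ[λ]`. -/
def curvePoly (l h₁ h₂ : ℂ) : ℂ[X][X] := X ^ 3 - C (C (l ^ 2)) * X - C (rhs h₁ h₂)

theorem natDegree_rhs (h₁ h₂ : ℂ) : (rhs h₁ h₂).natDegree = 5 := by
  unfold rhs; compute_degree!

theorem natDegree_curvePoly (l h₁ h₂ : ℂ) : (curvePoly l h₁ h₂).natDegree = 3 := by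
  unfold curvePoly; compute_degree!

theorem monic_curvePoly (l h₁ h₂ : ℂ) : (curvePoly l h₁ h₂).Monic := by
  unfold curvePoly; monicity!

theorem irreducible_curvePoly (l h₁ h₂ : ℂ) : Irreducible (curvePoly l h₁ h₂) := by
  have hd := natDegree_curvePoly l h₁ h₂
  rw [(monic_curvePoly l h₁ h₂).irreducible_iff_roots_eq_zero_of_degree_le_three
    (by omega) (by omega)]
  refine Multiset.eq_zero_of_forall_notMem fun r hr => ?_
  have h0 : r ^ 3 - C (l ^ 2) * r = rhs h₁ h₂ := by
    have := (mem_roots'.1 hr).2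
    simp only [IsRoot, curvePoly, eval_sub, eval_pow, eval_X, eval_mul, eval_C] at this
    exact sub_eq_zero.1 this
  have h5 := natDegree_rhs h₁ h₂
  rw [← h0] at h5
  rcases Nat.eq_zero_or_pos r.natDegree with hr0 | hr0
  · rw [eq_C_of_natDegree_eq_zero hr0, ← C_pow, ← C_mul, ← C_sub, natDegree_C] at h5
    omega
  · have hlt : (C (l ^ 2) * r).natDegree < (r ^ 3).natDegree := by
      rw [natDegree_pow]
      exact lt_of_le_of_lt (natDegree_C_mul_le _ _) (by omega)
    rw [natDegree_sub_eq_left_of_natDegree_lt hlt, natDegree_pow] at h5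
    omega

/-- The ring of regular functions on the affine spectral curve. -/
abbrev CoordRing (l h₁ h₂ : ℂ) : Type := AdjoinRoot (curvePoly l h₁ h₂)

instance (l h₁ h₂ : ℂ) : IsDomain (CoordRing l h₁ h₂) :=
  AdjoinRoot.isDomain_of_prime (irreducible_curvePoly l h₁ h₂).prime

/-- The function field of the spectral curve `S`; the points of (the smooth projective model of)
`S` are the places of this field. -/
abbrev FunField (l h₁ h₂ : ℂ) : Type := FractionRing (CoordRing l h₁ h₂)

section Spectral

variable (l h₁ h₂ : ℂ)

/-- The coordinate `λ` as a regular function. -/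
def lamA : CoordRing l h₁ h₂ := AdjoinRoot.of (curvePoly l h₁ h₂) X

/-- The coordinate `η` as a regular function. -/
def etaA : CoordRing l h₁ h₂ := AdjoinRoot.root (curvePoly l h₁ h₂)

/-- The coordinate `λ` as a rational function. -/
def lam : FunField l h₁ h₂ := algebraMap (CoordRing l h₁ h₂) (FunField l h₁ h₂) (lamA l h₁ h₂)

/-- The coordinate `η` as a rational function. -/
def eta : FunField l h₁ h₂ := algebraMap (CoordRing l h₁ h₂) (FunField l h₁ h₂) (etaA l h₁ h₂)

theorem aeval_lamA (p : ℂ[X]) :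
    aeval (lamA l h₁ h₂) p = AdjoinRoot.of (curvePoly l h₁ h₂) p := by
  have : aeval (lamA l h₁ h₂) = (AdjoinRoot.ofAlgHom ℂ (curvePoly l h₁ h₂)) := by
    ext; simp [lamA]
  rw [this]; rfl

theorem etaA_eq :
    etaA l h₁ h₂ ^ 3 - algebraMap ℂ _ (l ^ 2) * etaA l h₁ h₂
      - aeval (lamA l h₁ h₂) (rhs h₁ h₂) = 0 := by
  have key : ∀ (B : Type) [CommRing B] (i : ℂ[X] →+* B) (b : B),
      (curvePoly l h₁ h₂).eval₂ i b = b ^ 3 - i (C (l ^ 2)) * b - i (rhs h₁ h₂) := by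
    intro B _ i b
    simp only [curvePoly, eval₂_sub, eval₂_mul, eval₂_pow, eval₂_X, eval₂_C]
  have h := AdjoinRoot.eval₂_root (curvePoly l h₁ h₂)
  rw [key] at h
  rw [aeval_lamA]
  exact h

theorem rhs_neg {A : Type*} [CommRing A] [Algebra ℂ A] (a : A) :
    aeval (-a) (rhs h₁ h₂) = -aeval a (rhs h₁ h₂) := by
  simp only [rhs, map_add, map_sub, map_mul, map_pow, aeval_C, aeval_X]
  ring

/-- The pull-back of regular functions by `(λ, η) ↦ (-λ, -η)`. -/
def upsilonHom : CoordRing l h₁ h₂ →ₐ[ℂ] CoordRing l h₁ h₂ :=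
  AdjoinRoot.liftAlgHom (curvePoly l h₁ h₂) (aeval (-lamA l h₁ h₂)) (-etaA l h₁ h₂) (by
    simp only [curvePoly, eval₂_sub, eval₂_mul, eval₂_pow, eval₂_X, eval₂_C, RingHom.coe_coe,
      rhs_neg, aeval_C]
    linear_combination -(etaA_eq l h₁ h₂))

theorem upsilonHom_lamA : upsilonHom l h₁ h₂ (lamA l h₁ h₂) = -lamA l h₁ h₂ := by
  simp [upsilonHom, lamA]

theorem upsilonHom_etaA : upsilonHom l h₁ h₂ (etaA l h₁ h₂) = -etaA l h₁ h₂ := by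
  simp [upsilonHom, etaA]

theorem upsilonHom_comp :
    (upsilonHom l h₁ h₂).comp (upsilonHom l h₁ h₂) = AlgHom.id ℂ _ := by
  apply AdjoinRoot.algHom_ext'
  · ext
    change upsilonHom l h₁ h₂ (upsilonHom l h₁ h₂ (lamA l h₁ h₂)) = lamA l h₁ h₂
    rw [upsilonHom_lamA, map_neg, upsilonHom_lamA, neg_neg]
  · change upsilonHom l h₁ h₂ (upsilonHom l h₁ h₂ (etaA l h₁ h₂)) = etaA l h₁ h₂
    rw [upsilonHom_etaA, map_neg, upsilonHom_etaA, neg_neg]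

/-- The pull-back of regular functions by `(λ, η) ↦ (-λ, -η)`, as an automorphism. -/
def upsilonA : CoordRing l h₁ h₂ ≃ₐ[ℂ] CoordRing l h₁ h₂ :=
  AlgEquiv.ofAlgHom (upsilonHom l h₁ h₂) (upsilonHom l h₁ h₂)
    (upsilonHom_comp l h₁ h₂) (upsilonHom_comp l h₁ h₂)

/-- The involution `υ : (λ, η) ↦ (-λ, -η)` of `S`, through its pull-back on rational functions. -/
def upsilon : FunField l h₁ h₂ ≃ₐ[ℂ] FunField l h₁ h₂ :=
  IsFractionRing.fieldEquivOfAlgEquiv ℂ _ _ (upsilonA l h₁ h₂)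

theorem upsilon_lam : upsilon l h₁ h₂ (lam l h₁ h₂) = -lam l h₁ h₂ := by
  have h : upsilonA l h₁ h₂ (lamA l h₁ h₂) = -lamA l h₁ h₂ := upsilonHom_lamA l h₁ h₂
  simp [upsilon, lam, h]

theorem upsilon_eta : upsilon l h₁ h₂ (eta l h₁ h₂) = -eta l h₁ h₂ := by
  have h : upsilonA l h₁ h₂ (etaA l h₁ h₂) = -etaA l h₁ h₂ := upsilonHom_etaA l h₁ h₂
  simp [upsilon, eta, h]

/-- `(a, b)` satisfies the equation of the affine spectral curve. -/
def OnCurve (a b : ℂ) : Prop :=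
  b ^ 3 - l ^ 2 * b - 729 * a ^ 5 + 162 * h₁ * a ^ 3 - 9 * h₂ * a = 0

variable {l h₁ h₂}

/-- The point `P` of `S` has affine coordinates `(λ, η) = (a, b)`. -/
def HasCoords (P : Place (FunField l h₁ h₂)) (a b : ℂ) : Prop :=
  P.v (lam l h₁ h₂ - algebraMap ℂ _ a) < 1 ∧ P.v (eta l h₁ h₂ - algebraMap ℂ _ b) < 1

/-- The point `P` of `S` is the point at infinity, i.e. a pole of `λ`. -/
def IsInfinity (P : Place (FunField l h₁ h₂)) : Prop := 1 < P.v (lam l h₁ h₂)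

/-- `D` is the divisor of poles, on `S`, of some eigenvector `ψ` of the Lax matrix of `x`:
`L(λ) ψ(P) = η ψ(P)` for `P = (λ, η)` in `S`. -/
def IsEigenvectorDivisor (x : Phase) (D : Divisor (FunField l h₁ h₂)) : Prop :=
  ∃ ψ : Fin 3 → FunField l h₁ h₂,
    ψ ≠ 0 ∧ (laxL l x (lam l h₁ h₂)).mulVec ψ = eta l h₁ h₂ • ψ ∧ IsPoleDivisor ψ D

end Spectral

end

end HenonHeiles

open HenonHeiles

/-! Let `y = (1, Y₁, Y₂)` be the eigenvector of `L(μ)` defining the branch. A symmetry relating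
`L(-t)ᵀ` to `-L(t)` turns `y` into a left eigenvector `w = (μ, -Y₂, Y₁)` of `L(-μ)`, and `M(λ | μ)`
is, up to a constant unipotent factor on the left, the Darboux matrix `2 y wᵀ - (λ + μ)`. If `ψ` is
an eigenvector of `L(λ)`, then `M ψ` is one of `L'(λ)`, and its poles are found point by point:
after division by `λ + μ` they differ from those of `ψ` only by a zero at `Q_α`, where `ψ` is
proportional to `y`, and a pole at `υ(Q_α)`, where `w` does not annihilate `ψ`. So the shift divisor
is `υ(Q_α) - Q_α`. Its class is `(1 - υ)` applied to that of `∞ - Q_α`, as `υ` fixes `∞`; and the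
function `λ + μ` shows that the three points `υ(Q_i)` over `λ = -μ` add up to `3 ∞`. -/

namespace HenonHeiles

noncomputable section

section Residues

variable {F : Type*} [Field F] [Algebra ℂ F] {P : Place F} {f g : F} {a b : ℂ}

/-- The function `f` is regular at `P` and takes the value `c` there. -/
def Place.Res (P : Place F) (f : F) (c : ℂ) : Prop := P.v (f - algebraMap ℂ F c) < 1

theorem Place.v_algebraMap_le_one (P : Place F) (c : ℂ) : P.v (algebraMap ℂ F c) ≤ 1 := by
  rcases eq_or_ne c 0 with rfl | hc
  · simp
  · exact (P.trivial_on_const c hc).le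

theorem Place.res_algebraMap (P : Place F) (c : ℂ) : P.Res (algebraMap ℂ F c) c := by
  simp [Place.Res]

theorem Place.res_zero_iff : P.Res f 0 ↔ P.v f < 1 := by simp [Place.Res]

theorem Place.Res.v_le_one (h : P.Res f a) : P.v f ≤ 1 := by
  simpa using P.v.map_add_le h.le (P.v_algebraMap_le_one a)

theorem Place.Res.v_eq_one (h : P.Res f a) (ha : a ≠ 0) : P.v f = 1 := by
  have := P.v.map_add_eq_of_lt_left (h.trans_eq (P.trivial_on_const a ha).symm)
  rwa [add_sub_cancel, P.trivial_on_const a ha] at this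

theorem Place.Res.add (hf : P.Res f a) (hg : P.Res g b) : P.Res (f + g) (a + b) := by
  unfold Place.Res
  rw [map_add, add_sub_add_comm]
  exact P.v.map_add_lt hf hg

theorem Place.Res.mul (hf : P.Res f a) (hg : P.Res g b) : P.Res (f * g) (a * b) := by
  have h₁ : P.v ((f - algebraMap ℂ F a) * g) < 1 := by
    rw [map_mul]
    exact (mul_le_of_le_one_right' hg.v_le_one).trans_lt hf
  have h₂ : P.v (algebraMap ℂ F a * (g - algebraMap ℂ F b)) < 1 := by
    rw [map_mul]
    exact (mul_le_of_le_one_left' (P.v_algebraMap_le_one a)).trans_lt hg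
  unfold Place.Res
  convert P.v.map_add_lt h₁ h₂ using 2
  rw [map_mul]
  ring

theorem Place.Res.const_mul (hf : P.Res f a) (c : ℂ) : P.Res (algebraMap ℂ F c * f) (c * a) :=
  (P.res_algebraMap c).mul hf

theorem Place.Res.sub (hf : P.Res f a) (hg : P.Res g b) : P.Res (f - g) (a - b) := by
  simpa [sub_eq_add_neg] using hf.add (hg.const_mul (-1))

theorem Place.Res.inv (hf : P.Res f a) (ha : a ≠ 0) : P.Res f⁻¹ a⁻¹ := by
  have hf0 : f ≠ 0 := by
    rintro rfl
    simpa using hf.v_eq_one ha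
  have ha' : algebraMap ℂ F a ≠ 0 := by simpa using ha
  have h : f⁻¹ - algebraMap ℂ F a⁻¹ =
      -((f - algebraMap ℂ F a) * (f⁻¹ * algebraMap ℂ F a⁻¹)) := by
    rw [map_inv₀]
    field_simp
    ring
  unfold Place.Res
  rw [h, Valuation.map_neg, map_mul, map_mul, map_inv₀, hf.v_eq_one ha,
    P.trivial_on_const _ (inv_ne_zero ha)]
  simpa [Place.Res] using hf

theorem Place.Res.eq (hf : P.Res f a) (hf' : P.Res f b) : a = b := by
  by_contra hab
  simpa using (hf.sub hf').v_eq_one (sub_ne_zero.2 hab)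

theorem Place.Res.of_mul {c : ℂ} (hfg : P.Res (f * g) c) (hg : P.Res g b) (hb : b ≠ 0) :
    P.Res f (c * b⁻¹) := by
  have hg0 : g ≠ 0 := by
    rintro rfl
    simpa using hg.v_eq_one hb
  simpa [mul_assoc, hg0] using hfg.mul (hg.inv hb)

theorem Place.Res.sum {ι : Type*} {s : Finset ι} {f : ι → F} {c : ι → ℂ}
    (h : ∀ i ∈ s, P.Res (f i) (c i)) : P.Res (∑ i ∈ s, f i) (∑ i ∈ s, c i) := by
  unfold Place.Res
  rw [map_sum, ← Finset.sum_sub_distrib]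
  exact P.v.map_sum_lt one_ne_zero h

theorem Place.Res.pow (hf : P.Res f a) (n : ℕ) : P.Res (f ^ n) (a ^ n) := by
  induction n with
  | zero => simpa using P.res_algebraMap 1
  | succ n ih => simpa only [pow_succ] using ih.mul hf

theorem Place.Res.aeval (hf : P.Res f a) (p : ℂ[X]) : P.Res (aeval f p) (p.eval a) := by
  rw [aeval_eq_sum_range, eval_eq_sum_range]
  refine Place.Res.sum fun n _ => ?_
  rw [Algebra.smul_def]
  exact (hf.pow n).const_mul _

theorem Place.Res.dotProduct {ι : Type*} [Fintype ι] {φ χ : ι → F} {u w : ι → ℂ}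
    (hφ : ∀ i, P.Res (φ i) (u i)) (hχ : ∀ i, P.Res (χ i) (w i)) :
    P.Res (φ ⬝ᵥ χ) (u ⬝ᵥ w) :=
  Place.Res.sum fun i _ => (hφ i).mul (hχ i)

end Residues

section MaxVal

variable {K Γ₀ ι : Type*} [Field K] [LinearOrderedCommGroupWithZero Γ₀] [Fintype ι]
  (v : Valuation K Γ₀)

/-- The largest absolute value of the components of a vector: for the valuation of a place, the
exponential of the multiplicity of the pole divisor of the vector. -/
def maxVal (φ : ι → K) : Γ₀ := Finset.univ.sup fun i => v (φ i)

variable {v} {φ : ι → K} {r : Γ₀}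

theorem maxVal_le_iff : maxVal v φ ≤ r ↔ ∀ i, v (φ i) ≤ r := by
  simp [maxVal]

theorem le_maxVal (φ : ι → K) (i : ι) : v (φ i) ≤ maxVal v φ := maxVal_le_iff.1 le_rfl i

theorem exists_eq_maxVal [Nonempty ι] (v : Valuation K Γ₀) (φ : ι → K) :
    ∃ i, v (φ i) = maxVal v φ := by
  obtain ⟨i, -, hi⟩ := Finset.exists_mem_eq_sup _ Finset.univ_nonempty fun i => v (φ i)
  exact ⟨i, hi.symm⟩

theorem maxVal_smul [Nonempty ι] (c : K) (φ : ι → K) :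
    maxVal v (c • φ) = v c * maxVal v φ := by
  refine le_antisymm (maxVal_le_iff.2 fun i => ?_) ?_
  · rw [Pi.smul_apply, smul_eq_mul, map_mul]
    exact mul_le_mul_right (le_maxVal φ i) _
  · obtain ⟨i, hi⟩ := exists_eq_maxVal v φ
    rw [← hi, ← map_mul]
    exact le_maxVal (c • φ) i

theorem maxVal_ne_zero (h : φ ≠ 0) : maxVal v φ ≠ 0 := by
  obtain ⟨i, hi⟩ := Function.ne_iff.1 h
  intro h0
  exact hi (by simpa [h0] using le_maxVal (v := v) φ i)

theorem maxVal_mulVec_le {A : Matrix ι ι K} (hA : ∀ i j, v (A i j) ≤ r) (φ : ι → K) :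
    maxVal v (A.mulVec φ) ≤ r * maxVal v φ := by
  refine maxVal_le_iff.2 fun i => v.map_sum_le fun j _ => ?_
  rw [map_mul]
  exact mul_le_mul' (hA i j) (le_maxVal φ j)

theorem exists_maxVal_smul_eq_one [Nonempty ι] (v : Valuation K Γ₀) (h : φ ≠ 0) :
    ∃ c : K, c ≠ 0 ∧ maxVal v (c • φ) = 1 := by
  obtain ⟨i, hi⟩ := exists_eq_maxVal v φ
  have h0 : v (φ i) ≠ 0 := hi ▸ maxVal_ne_zero h
  refine ⟨(φ i)⁻¹, inv_ne_zero (by simpa using h0), ?_⟩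
  rw [maxVal_smul, ← hi, map_inv₀, inv_mul_cancel₀ h0]

variable {F : Type*} [Field F] [Algebra ℂ F] {P : Place F}

theorem isPoleDivisor_iff {ψ : Fin 3 → F} {D : Divisor F} :
    IsPoleDivisor ψ D ↔ ∀ P : Place F, maxVal P.v ψ = exp (D P) := by
  simp [IsPoleDivisor, maxVal, Fin.univ_succ, sup_assoc]

theorem maxVal_eq_one_of_res {φ : ι → F} {u : ι → ℂ} (h : ∀ i, P.Res (φ i) (u i))
    (hu : u ≠ 0) : maxVal P.v φ = 1 := by
  obtain ⟨i, hi⟩ := Function.ne_iff.1 hu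
  refine le_antisymm (maxVal_le_iff.2 fun j => (h j).v_le_one) ?_
  rw [← (h i).v_eq_one hi]
  exact le_maxVal φ i

theorem maxVal_lt_one_of_res [Nonempty ι] {φ : ι → F} (h : ∀ i, P.Res (φ i) 0) :
    maxVal P.v φ < 1 := by
  obtain ⟨i, hi⟩ := exists_eq_maxVal P.v φ
  exact hi ▸ Place.res_zero_iff.1 (h i)

theorem maxVal_map_mulVec_of_isUnit [DecidableEq ι] {A : Matrix ι ι ℂ} (hA : IsUnit A)
    (φ : ι → F) :
    maxVal P.v ((A.map (algebraMap ℂ F)).mulVec φ) = maxVal P.v φ := by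
  obtain ⟨⟨A, B, -, hBA⟩, rfl⟩ := hA
  have hle (C : Matrix ι ι ℂ) (χ : ι → F) :
      maxVal P.v ((C.map (algebraMap ℂ F)).mulVec χ) ≤ maxVal P.v χ :=
    (maxVal_mulVec_le (fun i j => P.v_algebraMap_le_one (C i j)) χ).trans_eq (one_mul _)
  refine le_antisymm (hle A φ) ?_
  simpa [Matrix.mulVec_mulVec, ← Matrix.map_mul, hBA] using
    hle B ((A.map (algebraMap ℂ F)).mulVec φ)

end MaxVal

section Divisors

variable {F : Type*} [Field F] [Algebra ℂ F]

open Classical in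
theorem pt_apply (P P' : Place F) : pt P P' = if P = P' then 1 else 0 :=
  Finsupp.single_apply

theorem cls_pt_map_sub_pt_mem_Prym {s : F ≃ₐ[ℂ] F} {O : Place F} (hO : O.map s = O)
    (P : Place F) : cls (pt (P.map s) - pt P) ∈ Prym s := by
  have hdiv (P : Place F) : divMap s (pt P) = pt (P.map s) := Finsupp.mapDomain_single
  refine ⟨cls (pt O - pt P), ⟨pt O - pt P, ?_, rfl⟩, ?_⟩
  · change degree F (pt O - pt P) = 0
    rw [map_sub]
    simp [degree, pt]
  · change cls (pt O - pt P) - cls (divMap s (pt O - pt P)) = cls (pt (P.map s) - pt P)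
    rw [map_sub, hdiv, hdiv, hO, cls, cls, cls, ← QuotientAddGroup.mk_sub,
      sub_sub_sub_cancel_left]

theorem IsPoleDivisor.linEquiv {ψ : Fin 3 → F} {D D' : Divisor F} {f : F} (hf : f ≠ 0)
    (hD : IsPoleDivisor ψ D) (hD' : IsPoleDivisor (f • ψ) D') : LinEquiv D D' := by
  refine ⟨f, hf, fun P => ?_⟩
  have h := isPoleDivisor_iff.1 hD' P
  rw [maxVal_smul, isPoleDivisor_iff.1 hD P] at h
  rw [Finsupp.sub_apply, neg_sub, exp_sub]
  exact eq_div_of_mul_eq exp_ne_zero h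

theorem IsPoleDivisor.ne_zero {ψ : Fin 3 → F} {D : Divisor F} (hD : IsPoleDivisor ψ D)
    (P : Place F) : ψ ≠ 0 := by
  rintro rfl
  simpa using (hD P).symm

end Divisors

section Uniformizer

variable {F : Type*} [Field F] [Algebra ℂ F] {S : Set (Place F)} {P : Place F} {t : F}

theorem le_exp_neg_one {x : ℤᵐ⁰} (h : x < 1) : x ≤ exp (-1) := by
  rw [← lt_mul_exp_iff_le exp_ne_zero, ← exp_add]
  simpa using h

theorem Place.v_eq_exp_one (ht : 1 < P.v t) (h : ∀ f ≠ 0, ∃ n : ℤ, P.v f = P.v t ^ n) :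
    P.v t = exp 1 := by
  obtain ⟨f, hf⟩ := P.surjective (exp 1)
  obtain ⟨n, hn⟩ := h f fun hf0 => exp_ne_zero (hf.symm.trans (by rw [hf0, map_zero]))
  have hlog : 0 < log (P.v t) := (lt_log_iff_exp_lt (zero_lt_one.trans ht).ne').2 ht
  have hmul : n * log (P.v t) = 1 := by
    rw [← smul_eq_mul, ← log_zpow, ← hn, hf, log_exp]
  rw [← exp_log (zero_lt_one.trans ht).ne', exp_inj]
  rcases Int.eq_one_or_neg_one_of_mul_eq_one' hmul with h | h <;> omega

theorem Place.subsingleton_of_forall_v_eq_zpow (ht : ∀ P ∈ S, 1 < P.v t)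
    (h : ∀ f ≠ 0, ∃ n : ℤ, ∀ P ∈ S, P.v f = P.v t ^ n) : S.Subsingleton := by
  have hexp (P) (hP : P ∈ S) : P.v t = exp 1 :=
    v_eq_exp_one (ht P hP) fun f hf => (h f hf).imp fun n hn => hn P hP
  intro P hP P' hP'
  ext f
  rcases eq_or_ne f 0 with rfl | hf
  · simp
  · obtain ⟨n, hn⟩ := h f hf
    rw [hn P hP, hn P' hP', hexp P hP, hexp P' hP']

end Uniformizer

section Darboux

variable {R ι : Type*} [CommRing R] [Fintype ι] [DecidableEq ι]

/-- The Darboux matrix `2 y wᵀ - r`, a rank one perturbation of a scalar matrix. -/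
def darboux (y w : ι → R) (r : R) : Matrix ι ι R := (2 : R) • Matrix.vecMulVec y w - r • 1

theorem darboux_mulVec (y w : ι → R) (r : R) (φ : ι → R) :
    (darboux y w r).mulVec φ = (2 * (w ⬝ᵥ φ)) • y - r • φ := by
  rw [darboux, Matrix.sub_mulVec, Matrix.smul_mulVec, Matrix.smul_mulVec, Matrix.one_mulVec,
    Matrix.vecMulVec_mulVec, op_smul_eq_smul, smul_smul]

theorem darboux_mulVec_darboux_mulVec (y w : ι → R) (r : R) (φ : ι → R) :
    (darboux y w (2 * (w ⬝ᵥ y) - r)).mulVec ((darboux y w r).mulVec φ) =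
      ((2 * (w ⬝ᵥ y) - r) * r) • φ := by
  ext i
  simp only [darboux_mulVec, dotProduct_sub, dotProduct_smul, Pi.sub_apply, Pi.smul_apply,
    smul_eq_mul]
  ring

theorem darboux_mulVec_eq_smul {y w : ι → R} {r c : R} {φ : ι → R} (hc : c * r = 2 * (w ⬝ᵥ φ)) :
    (darboux y w r).mulVec φ = r • (c • y - φ) := by
  rw [darboux_mulVec, ← hc, smul_sub, smul_smul, mul_comm]

section Valuation

variable {K Γ₀ : Type*} [Field K] [LinearOrderedCommGroupWithZero Γ₀] {v : Valuation K Γ₀}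
  {y w : ι → K}

theorem maxVal_darboux_mulVec_le (hy : ∀ i, v (y i) ≤ 1) (hw : ∀ i, v (w i) ≤ 1) (r : K)
    (φ : ι → K) : maxVal v ((darboux y w r).mulVec φ) ≤ max 1 (v r) * maxVal v φ := by
  have hdot : v (w ⬝ᵥ φ) ≤ maxVal v φ := v.map_sum_le fun j _ => by
    rw [map_mul]
    exact (mul_le_of_le_one_left' (hw j)).trans (le_maxVal φ j)
  rw [darboux_mulVec]
  refine maxVal_le_iff.2 fun i => v.map_sub_le ?_ ?_
  · rw [Pi.smul_apply, smul_eq_mul, map_mul, two_mul]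
    exact ((mul_le_of_le_one_right' (hy i)).trans (v.map_add_le hdot hdot)).trans
      (le_mul_of_one_le_left' (le_max_left _ _))
  · rw [Pi.smul_apply, smul_eq_mul, map_mul]
    exact mul_le_mul' (le_max_right _ _) (le_maxVal φ i)

theorem le_maxVal_darboux_mulVec [Nonempty ι] (hy : ∀ i, v (y i) ≤ 1) (hw : ∀ i, v (w i) ≤ 1)
    (r : K) (φ : ι → K) :
    v (2 * (w ⬝ᵥ y) - r) * v r * maxVal v φ ≤
      max 1 (v (2 * (w ⬝ᵥ y) - r)) * maxVal v ((darboux y w r).mulVec φ) := by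
  rw [← map_mul, ← maxVal_smul, ← darboux_mulVec_darboux_mulVec]
  exact maxVal_darboux_mulVec_le hy hw _ _

theorem maxVal_darboux_mulVec_of_one_le [Nonempty ι] (hy : ∀ i, v (y i) ≤ 1)
    (hw : ∀ i, v (w i) ≤ 1) {r : K} (hr : 1 ≤ v r) (hr' : 1 ≤ v (2 * (w ⬝ᵥ y) - r))
    (φ : ι → K) : maxVal v ((darboux y w r).mulVec φ) = v r * maxVal v φ := by
  refine le_antisymm ?_ ?_
  · simpa only [max_eq_right hr] using maxVal_darboux_mulVec_le hy hw r φ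
  · have h := le_maxVal_darboux_mulVec hy hw r φ
    rw [max_eq_right hr', mul_assoc] at h
    exact le_of_mul_le_mul_left h (zero_lt_one.trans_le hr')

end Valuation

section Residue

variable {F : Type*} [Field F] [Algebra ℂ F] {P : Place F} {y w u : ι → ℂ} {ψ : ι → F}
  {r c : F} {c₀ : ℂ}

theorem maxVal_darboux_mulVec_of_ne (hψ : ∀ i, P.Res (ψ i) (u i)) (hc : P.Res c c₀)
    (hcr : c * r = 2 * ((algebraMap ℂ F ∘ w) ⬝ᵥ ψ)) (hne : c₀ • y ≠ u) :
    maxVal P.v ((darboux (algebraMap ℂ F ∘ y) (algebraMap ℂ F ∘ w) r).mulVec ψ) = P.v r := by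
  have : Nonempty ι := (Function.ne_iff.1 hne).nonempty
  have hres (i) : P.Res ((c • (algebraMap ℂ F ∘ y) - ψ) i) ((c₀ • y - u) i) :=
    (hc.mul (P.res_algebraMap (y i))).sub (hψ i)
  rw [darboux_mulVec_eq_smul hcr, maxVal_smul, maxVal_eq_one_of_res hres (sub_ne_zero.2 hne),
    mul_one]

theorem maxVal_darboux_mulVec_le_of_eq [Nonempty ι] (hψ : ∀ i, P.Res (ψ i) (u i))
    (hc : P.Res c c₀) (hcr : c * r = 2 * ((algebraMap ℂ F ∘ w) ⬝ᵥ ψ)) (heq : c₀ • y = u) :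
    maxVal P.v ((darboux (algebraMap ℂ F ∘ y) (algebraMap ℂ F ∘ w) r).mulVec ψ) ≤
      P.v r * exp (-1) := by
  subst heq
  rw [darboux_mulVec_eq_smul hcr, maxVal_smul]
  refine mul_le_mul_right (le_exp_neg_one (maxVal_lt_one_of_res fun i => ?_)) _
  simpa using (hc.mul (P.res_algebraMap (y i))).sub (hψ i)

theorem maxVal_darboux_mulVec_eq_one (hψ : ∀ i, P.Res (ψ i) (u i)) (hr : P.Res r 0)
    (hwu : w ⬝ᵥ u ≠ 0) (hy : y ≠ 0) :
    maxVal P.v ((darboux (algebraMap ℂ F ∘ y) (algebraMap ℂ F ∘ w) r).mulVec ψ) = 1 := by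
  have hdot : P.Res (2 * ((algebraMap ℂ F ∘ w) ⬝ᵥ ψ)) (2 * (w ⬝ᵥ u)) := by
    rw [← map_ofNat (algebraMap ℂ F) 2]
    exact (Place.Res.dotProduct (fun i => P.res_algebraMap (w i)) hψ).const_mul 2
  rw [darboux_mulVec]
  refine maxVal_eq_one_of_res (u := (2 * (w ⬝ᵥ u)) • y - (0 : ℂ) • u)
    (fun i => (hdot.mul (P.res_algebraMap (y i))).sub (hr.mul (hψ i))) ?_
  rw [zero_smul, sub_zero]
  exact smul_ne_zero (mul_ne_zero two_ne_zero hwu) hy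

end Residue

end Darboux

section AffinePoints

variable {l h₁ h₂ a b : ℂ} {P : Place (FunField l h₁ h₂)}

theorem onCurve_iff_eq_eval_rhs :
    OnCurve l h₁ h₂ a b ↔ b ^ 3 - l ^ 2 * b = (rhs h₁ h₂).eval a := by
  rw [← sub_eq_zero, OnCurve]
  simp only [rhs, eval_add, eval_sub, eval_mul, eval_pow, eval_C, eval_X]
  ring_nf

theorem eta_eq :
    eta l h₁ h₂ ^ 3 - algebraMap ℂ _ (l ^ 2) * eta l h₁ h₂ = aeval (lam l h₁ h₂) (rhs h₁ h₂) := by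
  have h := congrArg (algebraMap (CoordRing l h₁ h₂) (FunField l h₁ h₂)) (etaA_eq l h₁ h₂)
  rw [map_zero, map_sub, map_sub, map_mul, map_pow, ← aeval_algebraMap_apply,
    ← IsScalarTower.algebraMap_apply] at h
  exact sub_eq_zero.1 h

theorem algebraMap_mk (p : ℂ[X][X]) :
    algebraMap (CoordRing l h₁ h₂) (FunField l h₁ h₂) (AdjoinRoot.mk _ p) =
      ∑ i ∈ p.support, aeval (lam l h₁ h₂) (p.coeff i) * eta l h₁ h₂ ^ i := by
  conv_lhs => rw [p.as_sum_support_C_mul_X_pow, map_sum, map_sum]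
  refine Finset.sum_congr rfl fun i _ => ?_
  rw [map_mul, map_mul, map_pow, map_pow, AdjoinRoot.mk_C, AdjoinRoot.mk_X, ← aeval_lamA,
    ← aeval_algebraMap_apply, ← lam, ← etaA, ← eta]

theorem HasCoords.res_lam (hP : HasCoords P a b) : P.Res (lam l h₁ h₂) a := hP.1

theorem HasCoords.res_eta (hP : HasCoords P a b) : P.Res (eta l h₁ h₂) b := hP.2

theorem HasCoords.onCurve (hP : HasCoords P a b) : OnCurve l h₁ h₂ a b := by
  have h := ((hP.res_eta.pow 3).sub (hP.res_eta.const_mul (l ^ 2))).eq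
    (eta_eq (l := l) ▸ hP.res_lam.aeval (rhs h₁ h₂))
  exact onCurve_iff_eq_eval_rhs.2 h

/-- Evaluation of regular functions at a point of the affine curve. -/
def evalAt (h : OnCurve l h₁ h₂ a b) : CoordRing l h₁ h₂ →ₐ[ℂ] ℂ :=
  AdjoinRoot.liftAlgHom (curvePoly l h₁ h₂) (aeval a) b (by
    simpa only [curvePoly, eval₂_sub, eval₂_mul, eval₂_pow, eval₂_X, eval₂_C, RingHom.coe_coe,
      aeval_C, coe_aeval_eq_eval, eval_C, sub_eq_zero, Algebra.algebraMap_self,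
      RingHom.id_apply] using onCurve_iff_eq_eval_rhs.1 h)

theorem evalAt_lamA (h : OnCurve l h₁ h₂ a b) : evalAt h (lamA l h₁ h₂) = a := by
  simp [evalAt, lamA]

theorem evalAt_etaA (h : OnCurve l h₁ h₂ a b) : evalAt h (etaA l h₁ h₂) = b := by
  simp [evalAt, etaA]

theorem HasCoords.res_evalAt (hP : HasCoords P a b) (g : CoordRing l h₁ h₂) :
    P.Res (algebraMap (CoordRing l h₁ h₂) (FunField l h₁ h₂) g) (evalAt hP.onCurve g) := by
  obtain ⟨p, rfl⟩ := AdjoinRoot.mk_surjective g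
  have hev : evalAt hP.onCurve (AdjoinRoot.mk _ p) =
      ∑ i ∈ p.support, (p.coeff i).eval a * b ^ i := by
    simp [evalAt, eval₂_eq_sum, Polynomial.sum]
  rw [algebraMap_mk, hev]
  exact Place.Res.sum fun i _ => (hP.res_lam.aeval _).mul (hP.res_eta.pow i)

theorem exists_eq_add_of_evalAt_eq_zero (h : OnCurve l h₁ h₂ a b) {g : CoordRing l h₁ h₂}
    (hg : evalAt h g = 0) : ∃ u w : CoordRing l h₁ h₂,
      u * (lamA l h₁ h₂ - algebraMap ℂ _ a) + w * (etaA l h₁ h₂ - algebraMap ℂ _ b) = g := by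
  set I : Ideal (CoordRing l h₁ h₂) :=
    Ideal.span {lamA l h₁ h₂ - algebraMap ℂ _ a, etaA l h₁ h₂ - algebraMap ℂ _ b}
  have hI : Ideal.Quotient.mkₐ ℂ I = (Algebra.ofId ℂ _).comp (evalAt h) := by
    refine AdjoinRoot.algHom_ext' (Polynomial.algHom_ext ?_) ?_
    · change Ideal.Quotient.mk I (lamA l h₁ h₂) = algebraMap ℂ _ (evalAt h (lamA l h₁ h₂))
      rw [evalAt_lamA]
      exact Ideal.Quotient.eq.2 (Ideal.subset_span (by simp))
    · change Ideal.Quotient.mk I (etaA l h₁ h₂) = algebraMap ℂ _ (evalAt h (etaA l h₁ h₂))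
      rw [evalAt_etaA]
      exact Ideal.Quotient.eq.2 (Ideal.subset_span (by simp))
  have hmk : Ideal.Quotient.mkₐ ℂ I g = 0 := by rw [hI, AlgHom.comp_apply, hg, map_zero]
  exact Ideal.mem_span_pair.1 (Ideal.Quotient.eq_zero_iff_mem.1 hmk)

theorem exists_mul_etaA_sub_eq (h : OnCurve l h₁ h₂ a b) : ∃ s r : CoordRing l h₁ h₂,
    evalAt h s = 3 * b ^ 2 - l ^ 2 ∧
      s * (etaA l h₁ h₂ - algebraMap ℂ _ b) = r * (lamA l h₁ h₂ - algebraMap ℂ _ a) := by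
  obtain ⟨r, hr⟩ := X_sub_C_dvd_sub_C_eval (a := a) (p := rhs h₁ h₂)
  have hr' := congrArg (aeval (lamA l h₁ h₂)) hr
  rw [← onCurve_iff_eq_eval_rhs.1 h] at hr'
  refine ⟨etaA l h₁ h₂ ^ 2 + algebraMap ℂ _ b * etaA l h₁ h₂ + algebraMap ℂ _ (b ^ 2 - l ^ 2),
    aeval (lamA l h₁ h₂) r, ?_, ?_⟩
  · simp only [map_add, map_mul, map_pow, evalAt_etaA, AlgHom.commutes, Algebra.algebraMap_self,
      RingHom.id_apply]
    ring
  · have hη := etaA_eq l h₁ h₂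
    simp only [map_sub, map_mul, map_pow, aeval_X, aeval_C] at hr' hη ⊢
    linear_combination hη + hr'

theorem exists_mul_eq_mul_lamA_sub (h : OnCurve l h₁ h₂ a b) {g : CoordRing l h₁ h₂}
    (hg : evalAt h g = 0) : ∃ s g' : CoordRing l h₁ h₂,
      evalAt h s = 3 * b ^ 2 - l ^ 2 ∧ s * g = g' * (lamA l h₁ h₂ - algebraMap ℂ _ a) := by
  obtain ⟨u, w, rfl⟩ := exists_eq_add_of_evalAt_eq_zero h hg
  obtain ⟨s, r, hs, hsr⟩ := exists_mul_etaA_sub_eq h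
  exact ⟨s, s * u + w * r, hs, by linear_combination w * hsr⟩

theorem algebraMap_lamA_sub (a : ℂ) :
    algebraMap (CoordRing l h₁ h₂) (FunField l h₁ h₂) (lamA l h₁ h₂ - algebraMap ℂ _ a) =
      lam l h₁ h₂ - algebraMap ℂ _ a := by
  rw [map_sub, ← IsScalarTower.algebraMap_apply, lam]

theorem algebraMap_mk_ne_zero {p : ℂ[X][X]} (hp : p ≠ 0) (hdeg : p.natDegree < 3) :
    algebraMap (CoordRing l h₁ h₂) (FunField l h₁ h₂) (AdjoinRoot.mk _ p) ≠ 0 := by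
  rw [Ne, FaithfulSMul.algebraMap_eq_zero_iff]
  exact AdjoinRoot.mk_ne_zero_of_natDegree_lt (monic_curvePoly l h₁ h₂) hp
    (by rwa [natDegree_curvePoly])

theorem aeval_add_aeval_mul_eta_ne_zero (p : ℂ[X]) {q : ℂ[X]} (hq : q ≠ 0) :
    aeval (lam l h₁ h₂) p + aeval (lam l h₁ h₂) q * eta l h₁ h₂ ≠ 0 := by
  have h := algebraMap_mk_ne_zero (l := l) (h₁ := h₁) (h₂ := h₂) (p := C q * X + C p)
    (fun h0 => hq (by simpa using congrArg (coeff · 1) h0)) (by compute_degree!)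
  rw [map_add, map_mul, AdjoinRoot.mk_C, AdjoinRoot.mk_C, AdjoinRoot.mk_X, ← aeval_lamA,
    ← aeval_lamA, map_add, map_mul, ← aeval_algebraMap_apply, ← aeval_algebraMap_apply] at h
  rwa [add_comm]

theorem lam_sub_ne_zero (a : ℂ) : lam l h₁ h₂ - algebraMap ℂ _ a ≠ 0 := by
  have h := algebraMap_mk_ne_zero (l := l) (h₁ := h₁) (h₂ := h₂)
    (C_ne_zero.2 (X_sub_C_ne_zero a)) (by simp)
  rwa [AdjoinRoot.mk_C, ← aeval_lamA, ← aeval_algebraMap_apply, map_sub, aeval_X, aeval_C] at h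

/-- The hypothesis `hb` says that the projection to the `λ`-line is unramified at `(a, b)`. -/
theorem HasCoords.exists_algebraMap_eq_pow_mul (hP : HasCoords P a b)
    (hb : 3 * b ^ 2 - l ^ 2 ≠ 0) {g : CoordRing l h₁ h₂} (hg : g ≠ 0) :
    ∃ (k : ℕ) (f : FunField l h₁ h₂) (c : ℂ), c ≠ 0 ∧
      (∀ P' : Place (FunField l h₁ h₂), HasCoords P' a b → P'.Res f c) ∧
      algebraMap _ (FunField l h₁ h₂) g = (lam l h₁ h₂ - algebraMap ℂ _ a) ^ k * f := by
  have hv : P.v (algebraMap _ (FunField l h₁ h₂) g) ≠ 0 := by simpa using hg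
  obtain ⟨n, hn⟩ := exists_exp_neg_natCast_lt hv
  induction n generalizing g with
  | zero =>
    refine ⟨0, algebraMap _ _ g, evalAt hP.onCurve g, fun h0 => ?_,
      fun P' hP' => hP'.res_evalAt g, by simp⟩
    have hlt := Place.res_zero_iff.1 (h0 ▸ hP.res_evalAt g)
    exact hlt.not_ge (by simpa using hn.le)
  | succ n ih =>
    by_cases hg0 : evalAt hP.onCurve g = 0
    · obtain ⟨s, g', hs, hsg⟩ := exists_mul_eq_mul_lamA_sub hP.onCurve hg0
      have hs0 : evalAt hP.onCurve s ≠ 0 := hs ▸ hb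
      have hsF : algebraMap _ (FunField l h₁ h₂) s ≠ 0 := fun h0 => by
        simpa [h0] using (hP.res_evalAt s).v_eq_one hs0
      have hsgF := congrArg (algebraMap _ (FunField l h₁ h₂)) hsg
      rw [map_mul, map_mul, algebraMap_lamA_sub] at hsgF
      have hvg := congrArg P.v hsgF
      rw [map_mul, map_mul, (hP.res_evalAt s).v_eq_one hs0, one_mul] at hvg
      have hn' : exp (-(n : ℤ)) < P.v (algebraMap _ (FunField l h₁ h₂) g') := by
        have h := hn.trans_le (hvg.le.trans (mul_le_mul_right (le_exp_neg_one hP.res_lam) _))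
        rw [Nat.cast_succ, neg_add, exp_add] at h
        exact lt_of_mul_lt_mul_right' h
      obtain ⟨k, f, c, hc, hf, hgf⟩ := ih (by rintro rfl; simp at hn') hn'.ne_bot hn'
      refine ⟨k + 1, f * (algebraMap _ _ s)⁻¹, c * (evalAt hP.onCurve s)⁻¹,
        mul_ne_zero hc (inv_ne_zero hs0),
        fun P' hP' => (hf P' hP').mul ((hP'.res_evalAt s).inv hs0), ?_⟩
      rw [hgf] at hsgF
      field_simp
      linear_combination hsgF
    · exact ⟨0, algebraMap _ _ g, _, hg0, fun P' hP' => hP'.res_evalAt g, by simp⟩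

theorem HasCoords.exists_eq_zpow_mul (hP : HasCoords P a b) (hb : 3 * b ^ 2 - l ^ 2 ≠ 0)
    {f : FunField l h₁ h₂} (hf : f ≠ 0) :
    ∃ (n : ℤ) (u : FunField l h₁ h₂) (c : ℂ), c ≠ 0 ∧
      (∀ P' : Place (FunField l h₁ h₂), HasCoords P' a b → P'.Res u c) ∧
      f = (lam l h₁ h₂ - algebraMap ℂ _ a) ^ n * u := by
  obtain ⟨g, d, hd, rfl⟩ := IsFractionRing.div_surjective (A := CoordRing l h₁ h₂) f
  have hg : g ≠ 0 := by
    rintro rfl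
    simp at hf
  obtain ⟨k, u, c, hc, hu, hgu⟩ := hP.exists_algebraMap_eq_pow_mul hb hg
  obtain ⟨m, w, c', hc', hw, hdw⟩ :=
    hP.exists_algebraMap_eq_pow_mul hb (nonZeroDivisors.ne_zero hd)
  refine ⟨k - m, u * w⁻¹, c * c'⁻¹, mul_ne_zero hc (inv_ne_zero hc'),
    fun P' hP' => (hu P' hP').mul ((hw P' hP').inv hc'), ?_⟩
  rw [hgu, hdw, zpow_sub₀ (lam_sub_ne_zero a), zpow_natCast, zpow_natCast]
  ring

theorem HasCoords.exists_forall_v_eq_zpow (hP : HasCoords P a b) (hb : 3 * b ^ 2 - l ^ 2 ≠ 0)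
    (f : FunField l h₁ h₂) (hf : f ≠ 0) :
    ∃ n : ℤ, ∀ P' ∈ {P' : Place (FunField l h₁ h₂) | HasCoords P' a b},
      P'.v f = P'.v (lam l h₁ h₂ - algebraMap ℂ _ a)⁻¹ ^ n := by
  obtain ⟨n, u, c, hc, hu, rfl⟩ := hP.exists_eq_zpow_mul hb hf
  refine ⟨-n, fun P' hP' => ?_⟩
  rw [map_mul, (hu P' hP').v_eq_one hc, map_zpow₀, map_inv₀, mul_one, inv_zpow', neg_neg]

theorem HasCoords.one_lt_v_inv (hP : HasCoords P a b) :
    1 < P.v (lam l h₁ h₂ - algebraMap ℂ _ a)⁻¹ := by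
  rw [map_inv₀]
  exact (one_lt_inv₀ (zero_lt_iff.2 (by simpa using lam_sub_ne_zero a))).2 hP.1

theorem HasCoords.v_lam_sub (hP : HasCoords P a b) (hb : 3 * b ^ 2 - l ^ 2 ≠ 0) :
    P.v (lam l h₁ h₂ - algebraMap ℂ _ a) = exp (-1) := by
  have h := Place.v_eq_exp_one hP.one_lt_v_inv fun f hf =>
    (hP.exists_forall_v_eq_zpow hb f hf).imp fun n hn => hn P hP
  rw [exp_neg, ← h, map_inv₀, inv_inv]

theorem HasCoords.eq_of_hasCoords {P' : Place (FunField l h₁ h₂)} (hP : HasCoords P a b)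
    (hP' : HasCoords P' a b) (hb : 3 * b ^ 2 - l ^ 2 ≠ 0) : P = P' :=
  Place.subsingleton_of_forall_v_eq_zpow (fun _ h => h.one_lt_v_inv)
    (hP.exists_forall_v_eq_zpow hb) hP hP'

theorem HasCoords.map_upsilon (hP : HasCoords P a b) :
    HasCoords (P.map (upsilon l h₁ h₂)) (-a) (-b) := by
  have hneg (f : FunField l h₁ h₂) (c : ℂ) :
      P.v (-f + algebraMap ℂ _ c) = P.v (f - algebraMap ℂ _ c) := by
    rw [← Valuation.map_neg]
    ring_nf
  simpa [HasCoords, Place.map, upsilon_lam, upsilon_eta, hneg] using hP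

theorem HasCoords.eq_iff {P' : Place (FunField l h₁ h₂)} {a' b' : ℂ} (hP : HasCoords P a b)
    (hP' : HasCoords P' a' b') (hb : 3 * b ^ 2 - l ^ 2 ≠ 0) : P = P' ↔ a = a' ∧ b = b' := by
  constructor
  · rintro rfl
    exact ⟨hP.res_lam.eq hP'.res_lam, hP.res_eta.eq hP'.res_eta⟩
  · rintro ⟨rfl, rfl⟩
    exact hP.eq_of_hasCoords hP' hb

end AffinePoints

section Fibre

variable {l h₁ h₂ a : ℂ} {e : Fin 3 → ℂ}

theorem prod_X_sub_C_eq_of_onCurve (h : ∀ i, OnCurve l h₁ h₂ a (e i))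
    (he : Function.Injective e) :
    ∏ i, (X - C (e i)) = X ^ 3 - C (l ^ 2) * X - C ((rhs h₁ h₂).eval a) := by
  have hmonic : (X ^ 3 - C (l ^ 2) * X - C ((rhs h₁ h₂).eval a)).Monic := by monicity!
  have hdeg : (X ^ 3 - C (l ^ 2) * X - C ((rhs h₁ h₂).eval a)).degree = 3 := by
    compute_degree!
  have hprod : (∏ i, (X - C (e i))).degree = 3 := by simp [degree_prod]
  refine eq_of_degree_le_of_eval_index_eq Finset.univ he.injOn hprod.le
    (hprod.trans hdeg.symm) ?_ fun i _ => ?_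
  · rw [hmonic, (monic_prod_X_sub_C e Finset.univ).leadingCoeff]
  · have hi : e i ^ 3 - l ^ 2 * e i - (rhs h₁ h₂).eval a = 0 :=
      sub_eq_zero.2 (onCurve_iff_eq_eval_rhs.1 (h i))
    rw [eval_prod, Finset.prod_eq_zero (Finset.mem_univ i) (by simp)]
    simpa using hi.symm

theorem deriv_ne_zero_of_onCurve (h : ∀ i, OnCurve l h₁ h₂ a (e i))
    (he : Function.Injective e) (i : Fin 3) : 3 * e i ^ 2 - l ^ 2 ≠ 0 := by
  have hsep := separable_prod_X_sub_C_iff.2 he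
  rw [prod_X_sub_C_eq_of_onCurve h he] at hsep
  have := hsep.eval₂_derivative_ne_zero (RingHom.id ℂ) (x := e i) (by
    simpa [sub_eq_zero] using onCurve_iff_eq_eval_rhs.1 (h i))
  simpa [derivative_pow, -map_pow] using this

theorem exists_hasCoords_of_res_lam (h : ∀ i, OnCurve l h₁ h₂ a (e i))
    (he : Function.Injective e) {P : Place (FunField l h₁ h₂)} (hP : P.Res (lam l h₁ h₂) a) :
    ∃ i, HasCoords P a (e i) := by
  have hprod : ∏ i, (eta l h₁ h₂ - algebraMap ℂ _ (e i)) =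
      aeval (lam l h₁ h₂) (rhs h₁ h₂) - algebraMap ℂ _ ((rhs h₁ h₂).eval a) := by
    have := congrArg (aeval (eta l h₁ h₂)) (prod_X_sub_C_eq_of_onCurve h he)
    simpa [map_prod, ← eta_eq] using this
  have hlt : ∏ i, P.v (eta l h₁ h₂ - algebraMap ℂ _ (e i)) < 1 := by
    rw [← map_prod, hprod]
    exact hP.aeval (rhs h₁ h₂)
  by_contra! hnot
  refine hlt.not_ge (Finset.one_le_prod'' fun i => ?_)
  exact not_lt.1 fun hi => hnot i ⟨hP, hi⟩

end Fibre

section Infinity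

theorem Place.v_aeval_of_one_lt {F : Type*} [Field F] [Algebra ℂ F] {P : Place F} {f : F}
    (h : 1 < P.v f) {p : ℂ[X]} (hp : p ≠ 0) : P.v (aeval f p) = P.v f ^ p.natDegree := by
  have hlead : P.v (p.coeff p.natDegree • f ^ p.natDegree) = P.v f ^ p.natDegree := by
    rw [Algebra.smul_def, map_mul, map_pow, P.trivial_on_const _ (by simpa using hp), one_mul]
  rw [aeval_eq_sum_range, Finset.sum_range_succ, P.v.map_add_eq_of_lt_right, hlead]
  rw [hlead]
  refine P.v.map_sum_lt (pow_ne_zero _ (zero_lt_one.trans h).ne') fun i hi => ?_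
  rw [Algebra.smul_def, map_mul, map_pow]
  exact (mul_le_of_le_one_left' (P.v_algebraMap_le_one _)).trans_lt
    (pow_lt_pow_right₀ h (Finset.mem_range.1 hi))

variable {l h₁ h₂ : ℂ} {P P' : Place (FunField l h₁ h₂)}

theorem IsInfinity.map_upsilon (h : IsInfinity P) : IsInfinity (P.map (upsilon l h₁ h₂)) := by
  simpa [IsInfinity, Place.map, upsilon_lam] using h

theorem IsInfinity.v_eta_pow (h : IsInfinity P) :
    P.v (eta l h₁ h₂) ^ 3 = P.v (lam l h₁ h₂) ^ 5 := by
  have hrhs0 : rhs h₁ h₂ ≠ 0 := fun h0 => by simpa [h0] using natDegree_rhs h₁ h₂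
  have hrhs := Place.v_aeval_of_one_lt h hrhs0
  rw [natDegree_rhs, ← eta_eq] at hrhs
  have heta : 1 < P.v (eta l h₁ h₂) := by
    by_contra! hle
    have hcubic : P.v (eta l h₁ h₂ ^ 3 - algebraMap ℂ _ (l ^ 2) * eta l h₁ h₂) ≤ 1 := by
      refine P.v.map_sub_le ?_ ?_
      · rw [map_pow]
        exact pow_le_one' hle _
      · rw [map_mul]
        exact mul_le_one' (P.v_algebraMap_le_one _) hle
    exact (one_lt_pow₀ h (by norm_num)).not_ge (hrhs.symm.trans_le hcubic)
  have hlin : P.v (algebraMap ℂ _ (l ^ 2) * eta l h₁ h₂) < P.v (eta l h₁ h₂ ^ 3) := by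
    rw [map_mul, map_pow P.v]
    exact (mul_le_of_le_one_left' (P.v_algebraMap_le_one _)).trans_lt
      (lt_self_pow₀ heta (by norm_num))
  rwa [P.v.map_sub_eq_of_lt_left hlin, map_pow] at hrhs

theorem IsInfinity.v_lam_ne_zero (h : IsInfinity P) : P.v (lam l h₁ h₂) ≠ 0 :=
  (zero_lt_one.trans h).ne'

theorem IsInfinity.v_eta_ne_zero (h : IsInfinity P) : P.v (eta l h₁ h₂) ≠ 0 :=
  fun h0 => pow_ne_zero 5 h.v_lam_ne_zero (by rw [← h.v_eta_pow, h0, zero_pow three_ne_zero])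

theorem IsInfinity.v_lam (h : IsInfinity P) :
    P.v (lam l h₁ h₂) = P.v (lam l h₁ h₂ ^ 2 / eta l h₁ h₂) ^ 3 := by
  have hl := h.v_lam_ne_zero
  rw [map_div₀, map_pow, div_pow, h.v_eta_pow, eq_div_iff (pow_ne_zero _ hl), ← pow_succ',
    ← pow_mul]

theorem IsInfinity.v_eta (h : IsInfinity P) :
    P.v (eta l h₁ h₂) = P.v (lam l h₁ h₂ ^ 2 / eta l h₁ h₂) ^ 5 := by
  have he := h.v_eta_ne_zero
  rw [map_div₀, map_pow, div_pow, eq_div_iff (pow_ne_zero _ he), ← pow_mul,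
    show 2 * 5 = 5 * 2 from rfl, pow_mul, ← h.v_eta_pow, ← pow_succ',
    ← pow_mul]

theorem IsInfinity.one_lt_v_uniformizer (h : IsInfinity P) :
    1 < P.v (lam l h₁ h₂ ^ 2 / eta l h₁ h₂) := by
  rw [← one_lt_pow_iff three_ne_zero, ← h.v_lam]
  exact h

theorem IsInfinity.v_aeval_mul_eta_pow (h : IsInfinity P) {p : ℂ[X]} (hp : p ≠ 0) (i : ℕ) :
    P.v (aeval (lam l h₁ h₂) p * eta l h₁ h₂ ^ i) =
      P.v (lam l h₁ h₂ ^ 2 / eta l h₁ h₂) ^ (3 * p.natDegree + 5 * i) := by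
  rw [map_mul, Place.v_aeval_of_one_lt h hp, map_pow, pow_add, pow_mul, pow_mul, ← h.v_lam,
    ← h.v_eta]

/-- The terms `pᵢ(λ) ηⁱ` with `i < 3` have pole orders `3 deg pᵢ + 5 i`, pairwise distinct
modulo `3`, so that no cancellation takes place in their sum. -/
theorem exists_forall_isInfinity_v_algebraMap_mk_eq_pow {p : ℂ[X][X]} (hp : p ≠ 0)
    (hdeg : p.natDegree < 3) : ∃ n : ℕ, ∀ P : Place (FunField l h₁ h₂), IsInfinity P →
      P.v (algebraMap (CoordRing l h₁ h₂) (FunField l h₁ h₂) (AdjoinRoot.mk _ p)) =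
        P.v (lam l h₁ h₂ ^ 2 / eta l h₁ h₂) ^ n := by
  obtain ⟨j, hj, hmax⟩ := p.support.exists_max_image
    (fun i => 3 * (p.coeff i).natDegree + 5 * i) (support_nonempty.2 hp)
  refine ⟨_, fun P hP => (congrArg P.v (algebraMap_mk p)).trans <|
    (P.v.map_sum_eq_of_lt hj fun i hi => ?_).trans
      (hP.v_aeval_mul_eta_pow (mem_support_iff.1 hj) j)⟩
  obtain ⟨hi, hij⟩ := Finset.mem_sdiff.1 hi
  rw [hP.v_aeval_mul_eta_pow (mem_support_iff.1 hi), hP.v_aeval_mul_eta_pow (mem_support_iff.1 hj)]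
  refine pow_lt_pow_right₀ hP.one_lt_v_uniformizer ((hmax i hi).lt_of_ne fun heq => hij ?_)
  have := le_natDegree_of_mem_supp i hi
  have := le_natDegree_of_mem_supp j hj
  rw [Finset.mem_singleton]
  omega

theorem exists_forall_isInfinity_v_eq_zpow (f : FunField l h₁ h₂) (hf : f ≠ 0) :
    ∃ n : ℤ, ∀ P ∈ {P : Place (FunField l h₁ h₂) | IsInfinity P},
      P.v f = P.v (lam l h₁ h₂ ^ 2 / eta l h₁ h₂) ^ n := by
  have hpow {g : CoordRing l h₁ h₂} (hg : g ≠ 0) : ∃ n : ℕ,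
      ∀ P : Place (FunField l h₁ h₂), IsInfinity P →
        P.v (algebraMap _ (FunField l h₁ h₂) g) = P.v (lam l h₁ h₂ ^ 2 / eta l h₁ h₂) ^ n := by
    obtain ⟨p, rfl⟩ := AdjoinRoot.mk_surjective g
    have hmod : AdjoinRoot.mk (curvePoly l h₁ h₂) (p %ₘ curvePoly l h₁ h₂) =
        AdjoinRoot.mk _ p := by
      rw [AdjoinRoot.mk_eq_mk, modByMonic_eq_sub_mul_div _ (curvePoly l h₁ h₂), sub_sub_cancel_left]
      exact (dvd_mul_right _ _).neg_right
    rw [← hmod] at hg ⊢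
    refine exists_forall_isInfinity_v_algebraMap_mk_eq_pow (fun h0 => hg (by rw [h0, map_zero])) ?_
    rw [← natDegree_curvePoly l h₁ h₂]
    refine natDegree_modByMonic_lt _ (monic_curvePoly l h₁ h₂) fun h1 => ?_
    simpa [h1] using natDegree_curvePoly l h₁ h₂
  obtain ⟨g, d, hd, rfl⟩ := IsFractionRing.div_surjective (A := CoordRing l h₁ h₂) f
  obtain ⟨m, hm⟩ := hpow (g := g) (by rintro rfl; simp at hf)
  obtain ⟨n, hn⟩ := hpow (nonZeroDivisors.ne_zero hd)
  refine ⟨m - n, fun P hP => ?_⟩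
  rw [map_div₀, hm P hP, hn P hP, zpow_sub₀ (zero_lt_one.trans hP.one_lt_v_uniformizer).ne',
    zpow_natCast, zpow_natCast]

theorem IsInfinity.v_lam_eq_exp (h : IsInfinity P) : P.v (lam l h₁ h₂) = exp 3 := by
  rw [h.v_lam, Place.v_eq_exp_one h.one_lt_v_uniformizer fun f hf =>
    (exists_forall_isInfinity_v_eq_zpow f hf).imp fun n hn => hn P h]
  rfl

theorem IsInfinity.eq_of_isInfinity (h : IsInfinity P) (h' : IsInfinity P') : P = P' :=
  Place.subsingleton_of_forall_v_eq_zpow (fun _ hP => hP.one_lt_v_uniformizer)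
    exists_forall_isInfinity_v_eq_zpow h h'

end Infinity

section LaxDual

variable {R : Type*} [CommRing R]

/-- The symmetry between `L(t)` and `-L(-t)ᵀ`: it turns an eigenvector `u` of `L(t)` into a left
eigenvector of `L(-t)`, for the opposite eigenvalue. -/
def laxDual (t : R) (u : Fin 3 → R) : Fin 3 → R := ![t * u 0, -u 2, u 1]

theorem laxDual_smul (t c : R) (u : Fin 3 → R) : laxDual t (c • u) = c • laxDual t u := by
  ext i
  fin_cases i <;> simp [laxDual, mul_left_comm]

theorem laxDual_dotProduct_self (t : R) (u : Fin 3 → R) : laxDual t u ⬝ᵥ u = t * u 0 ^ 2 := by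
  simp only [laxDual, dotProduct, Fin.sum_univ_three, Matrix.cons_val]
  ring

end LaxDual

section Lax

variable {R S : Type*} [CommRing R] [Algebra ℂ R] [CommRing S] [Algebra ℂ S]

theorem laxL_map (l : ℂ) (x : Phase) (t : R) (f : R →ₐ[ℂ] S) :
    laxL l x (f t) = (laxL l x t).map f := by
  ext i j
  fin_cases i <;> fin_cases j <;> simp [laxL, map_ofNat f]

/-- The divided difference `(L(t) - L(s)) / (t - s)` of the Lax matrix, which depends on `t + s`
only. -/
def laxSlope (x : Phase) (r : R) : Matrix (Fin 3) (Fin 3) R :=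
  let c : ℂ → R := algebraMap ℂ R
  !![c (6 * x.q₁), 0, 9;
     9 * r + c (3 * x.p₁), -c (3 * x.q₁), 0;
     -c ((3 * x.q₁ ^ 2 + x.q₂ ^ 2) / 2), 9 * r, -c (3 * x.q₁)]

theorem laxSlope_map (x : Phase) (r : R) (f : R →ₐ[ℂ] S) :
    laxSlope x (f r) = (laxSlope x r).map f := by
  ext i j
  fin_cases i <;> fin_cases j <;> simp [laxSlope, map_ofNat f]

theorem laxL_sub_laxL (l : ℂ) (x : Phase) (t s : R) :
    laxL l x t - laxL l x s = (t - s) • laxSlope x (t + s) := by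
  ext i j
  fin_cases i <;> fin_cases j <;> simp [laxL, laxSlope, map_ofNat (algebraMap ℂ R)] <;> ring

theorem add_mul_dotProduct_eq {l : ℂ} {x : Phase} {s t b d : R} {w φ : Fin 3 → R}
    (hw : Matrix.vecMul w (laxL l x (-s)) = -b • w) (hφ : (laxL l x t).mulVec φ = d • φ) :
    (d + b) * (w ⬝ᵥ φ) = (t + s) * (w ⬝ᵥ (laxSlope x (t - s)).mulVec φ) := by
  have h := congrArg (fun A => w ⬝ᵥ A.mulVec φ) (laxL_sub_laxL l x t (-s))
  simp only [Matrix.sub_mulVec, dotProduct_sub, hφ, Matrix.dotProduct_mulVec w (laxL l x (-s)), hw,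
    Matrix.smul_mulVec, smul_dotProduct, dotProduct_smul, smul_eq_mul] at h
  rw [sub_neg_eq_add, ← sub_eq_add_neg] at h
  linear_combination h

theorem laxDual_vecMul_laxL_neg (l : ℂ) (x : Phase) (t : R) (u : Fin 3 → R) :
    Matrix.vecMul (laxDual t u) (laxL l x (-t)) = -laxDual t ((laxL l x t).mulVec u) := by
  ext i
  fin_cases i <;>
    simp [laxDual, laxL, Matrix.mulVec, Matrix.vecMul, dotProduct, Fin.sum_univ_three] <;> ring

theorem vecMul_laxDual_of_eigenvector {l : ℂ} {x : Phase} {t b : R} {u : Fin 3 → R}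
    (hu : (laxL l x t).mulVec u = b • u) :
    Matrix.vecMul (laxDual t u) (laxL l x (-t)) = -b • laxDual t u := by
  rw [laxDual_vecMul_laxL_neg, hu, laxDual_smul, neg_smul]

theorem laxDual_dotProduct_laxSlope_mulVec (l : ℂ) (x : Phase) (t : R) (u : Fin 3 → R) :
    laxDual t u ⬝ᵥ (laxSlope x 0).mulVec u = (laxL l x t).mulVec u 0 * u 0 := by
  simp only [laxDual, laxSlope, laxL, Matrix.mulVec, dotProduct, Fin.sum_univ_three,
    Matrix.of_apply, Matrix.cons_val, map_mul, map_ofNat]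
  ring

/-- The constant unipotent matrix by which the intertwining matrix differs from a Darboux
matrix. -/
def gauge (y : Fin 3 → ℂ) : Matrix (Fin 3) (Fin 3) ℂ :=
  !![1, 0, 0; -2 * y 1, 1, 0; -2 * (y 2 - 2 * y 1 ^ 2), -2 * y 1, 1]

theorem isUnit_gauge (y : Fin 3 → ℂ) : IsUnit (gauge y) := by
  rw [Matrix.isUnit_iff_isUnit_det]
  simp [gauge, Matrix.det_fin_three]

/-- The Darboux matrix `2 y wᵀ - (t + μ)` of a vector `y` and of its dual `w = laxDual μ y`, for a
spectral parameter in any `ℂ`-algebra. -/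
def laxDarboux (μ : ℂ) (y : Fin 3 → ℂ) (t : R) : Matrix (Fin 3) (Fin 3) R :=
  darboux (algebraMap ℂ R ∘ y) (algebraMap ℂ R ∘ laxDual μ y) (t + algebraMap ℂ R μ)

theorem laxDarboux_map (μ : ℂ) (y : Fin 3 → ℂ) (t : R) (f : R →ₐ[ℂ] S) :
    laxDarboux μ y (f t) = (laxDarboux μ y t).map f := by
  ext i j
  simp [laxDarboux, darboux, Matrix.vecMulVec_apply, Matrix.one_apply, apply_ite f, map_ofNat f]

/-- The factorization of the intertwining matrix `M(t | μ)` through the Darboux matrix of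
`y = (1, Y₁, Y₂)`, for a spectral parameter in any `ℂ`-algebra. -/
def intertwiner (μ : ℂ) (y : Fin 3 → ℂ) (t : R) : Matrix (Fin 3) (Fin 3) R :=
  (gauge y).map (algebraMap ℂ R) * laxDarboux μ y t

theorem intertwiner_map (μ : ℂ) (y : Fin 3 → ℂ) (t : R) (f : R →ₐ[ℂ] S) :
    intertwiner μ y (f t) = (intertwiner μ y t).map f := by
  rw [intertwiner, intertwiner, laxDarboux_map, Matrix.map_mul]
  congr 1
  ext i j
  simp

theorem matM_eq_intertwiner (μ Y₁ Y₂ t : ℂ) :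
    matM μ Y₁ Y₂ t = intertwiner μ ![1, Y₁, Y₂] t := by
  ext i j
  fin_cases i <;> fin_cases j <;>
    simp [matM, intertwiner, gauge, laxDarboux, darboux, laxDual, Matrix.mul_apply,
      Fin.sum_univ_three] <;> ring

theorem laxL_mul_intertwiner_of_forall {l μ : ℂ} {x x' : Phase} {y : Fin 3 → ℂ}
    (h : ∀ t : ℂ, laxL l x' t * intertwiner μ y t = intertwiner μ y t * laxL l x t) (t : R) :
    laxL l x' t * intertwiner μ y t = intertwiner μ y t * laxL l x t := by
  have hX : laxL l x' (X : ℂ[X]) * intertwiner μ y X = intertwiner μ y X * laxL l x X := by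
    ext1 i j
    refine Polynomial.funext fun s => ?_
    have hs := congrFun (congrFun (h s) i) j
    rw [show s = aeval s (X : ℂ[X]) by simp, laxL_map, laxL_map, intertwiner_map,
      ← Matrix.map_mul, ← Matrix.map_mul] at hs
    simpa using hs
  rw [show t = aeval t (X : ℂ[X]) by simp, laxL_map, laxL_map, intertwiner_map,
    ← Matrix.map_mul, ← Matrix.map_mul, hX]

end Lax

section SimpleSpectrum

variable {K ι : Type*} [Field K] [Fintype ι] {A : Matrix ι ι K} {e : ι → K}
  {i : ι} {u w : ι → K}

theorem exists_linearIndependent_eigenvectors (he : Function.Injective e)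
    (hA : ∀ j, ∃ v ≠ 0, A.mulVec v = e j • v) (hu : u ≠ 0) (hAu : A.mulVec u = e i • u) :
    ∃ v : ι → ι → K, LinearIndependent K v ∧ v i = u ∧ ∀ j, A.mulVec (v j) = e j • v j := by
  have hA' (j) : ∃ v ≠ 0, A.mulVec v = e j • v ∧ (j = i → v = u) := by
    rcases eq_or_ne j i with rfl | hj
    · exact ⟨u, hu, hAu, fun _ => rfl⟩
    · obtain ⟨v, hv, hAv⟩ := hA j
      exact ⟨v, hv, hAv, fun h => absurd h hj⟩
  choose v hv hAv hvi using hA'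
  refine ⟨v, ?_, hvi i rfl, hAv⟩
  exact Module.End.eigenvectors_linearIndependent' (Matrix.mulVecLin A) e he v fun j =>
    ⟨Module.End.mem_eigenspace_iff.2 (hAv j), hv j⟩

theorem exists_eq_smul_of_mulVec_eq_smul (he : Function.Injective e)
    (hA : ∀ j, ∃ v ≠ 0, A.mulVec v = e j • v) (hu : u ≠ 0) (hAu : A.mulVec u = e i • u)
    (hAw : A.mulVec w = e i • w) : ∃ k : K, w = k • u := by
  obtain ⟨v, hli, rfl, hAv⟩ := exists_linearIndependent_eigenvectors he hA hu hAu
  have hspan := hli.span_eq_top_of_card_eq_finrank' (by simp)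
  obtain ⟨c, rfl⟩ :=
    (Submodule.mem_span_range_iff_exists_fun K).1 (hspan ▸ Submodule.mem_top : w ∈ _)
  have h0 : ∑ j, (c j * (e j - e i)) • v j = 0 := by
    rw [Matrix.mulVec_sum, Finset.smul_sum, ← sub_eq_zero, ← Finset.sum_sub_distrib] at hAw
    rw [← hAw]
    refine Finset.sum_congr rfl fun j _ => ?_
    rw [Matrix.mulVec_smul, hAv]
    module
  refine ⟨c i, Finset.sum_eq_single i (fun j _ hj => ?_) (by simp)⟩
  have hcj := Fintype.linearIndependent_iff.1 hli _ h0 j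
  rw [(mul_eq_zero.1 hcj).resolve_right (sub_ne_zero.2 (he.ne hj)), zero_smul]

theorem dotProduct_ne_zero_of_eigenvectors (he : Function.Injective e)
    (hA : ∀ j, ∃ v ≠ 0, A.mulVec v = e j • v) (hu : u ≠ 0) (hAu : A.mulVec u = e i • u)
    (hw : w ≠ 0) (hwA : Matrix.vecMul w A = e i • w) : w ⬝ᵥ u ≠ 0 := by
  classical
  obtain ⟨v, hli, rfl, hAv⟩ := exists_linearIndependent_eigenvectors he hA hu hAu
  intro h0
  have hortho (j) : v j ⬝ᵥ w = 0 := by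
    rw [dotProduct_comm]
    rcases eq_or_ne j i with rfl | hj
    · exact h0
    · have h := Matrix.dotProduct_mulVec w A (v j)
      rw [hAv, hwA, dotProduct_smul, smul_dotProduct, smul_eq_mul, smul_eq_mul] at h
      exact (mul_eq_mul_right_iff.1 h).resolve_left (he.ne hj)
  have hunit : IsUnit (Matrix.of v) := Matrix.linearIndependent_rows_iff_isUnit.1 hli
  exact hw (Matrix.mulVec_injective_of_isUnit hunit (by
    rw [Matrix.mulVec_zero]
    exact funext hortho))

end SimpleSpectrum

section Eigenvectors

theorem Place.Res.map_aeval_mulVec {F ι : Type*} [Field F] [Algebra ℂ F] [Fintype ι]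
    {P : Place F} {f : F} {t : ℂ} {φ : ι → F} {u : ι → ℂ} (hf : P.Res f t)
    (hφ : ∀ i, P.Res (φ i) (u i)) (A : Matrix ι ι ℂ[X]) (i : ι) :
    P.Res ((A.map (Polynomial.aeval f)).mulVec φ i) ((A.map (Polynomial.aeval t)).mulVec u i) := by
  refine Place.Res.dotProduct (fun j => ?_) hφ
  simpa only [Matrix.map_apply, coe_aeval_eq_eval] using hf.aeval (A i j)

variable {l h₁ h₂ a b : ℂ} {P : Place (FunField l h₁ h₂)} {x : Phase}
  {ψ ψ' : Fin 3 → FunField l h₁ h₂}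

theorem eq_zero_of_apply_zero_eq_zero
    (h : (laxL l x (lam l h₁ h₂)).mulVec ψ = eta l h₁ h₂ • ψ) (h0 : ψ 0 = 0) : ψ = 0 := by
  have hB : (C 9 * X - C (3 * x.p₁) : ℂ[X]) ≠ 0 := fun hB => by
    simpa [coeff_C] using congrArg (coeff · 1) hB
  have hminor := aeval_add_aeval_mul_eta_ne_zero (l := l) (h₁ := h₁) (h₂ := h₂)
    (-C ((3 * x.q₁ ^ 2 + x.q₂ ^ 2) / 2 * x.q₂ ^ 2)
      - (C 9 * X - C (3 * x.p₁)) * (-(C (3 * x.q₁) * X) - C (x.q₂ * x.p₂))) hB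
  have hrow₀ : -algebraMap ℂ _ ((3 * x.q₁ ^ 2 + x.q₂ ^ 2) / 2) * ψ 1 +
      (9 * lam l h₁ h₂ - 3 * algebraMap ℂ _ x.p₁) * ψ 2 = 0 := by
    simpa [laxL, Matrix.mulVec, dotProduct, Fin.sum_univ_three, h0] using congrFun h 0
  have hrow₁ : (-3 * lam l h₁ h₂ * algebraMap ℂ _ x.q₁ - algebraMap ℂ _ (x.q₂ * x.p₂)) * ψ 1 +
      algebraMap ℂ _ (x.q₂ ^ 2) * ψ 2 = eta l h₁ h₂ * ψ 1 := by
    simpa [laxL, Matrix.mulVec, dotProduct, Fin.sum_univ_three, h0] using congrFun h 1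
  have h1 : ψ 1 = 0 := by
    refine (mul_eq_zero.1 ?_).resolve_left hminor
    simp only [map_sub, map_neg, map_mul, aeval_C, aeval_X, map_ofNat] at hrow₀ hrow₁ ⊢
    linear_combination algebraMap ℂ (FunField l h₁ h₂) (x.q₂ ^ 2) * hrow₀
      - (9 * lam l h₁ h₂ - 3 * algebraMap ℂ _ x.p₁) * hrow₁
  have h2 : ψ 2 = 0 := by
    simpa [h1, x.q₂_ne_zero] using hrow₁
  ext i
  fin_cases i <;> simp [h0, h1, h2]

theorem exists_eq_smul_of_eigenvectors (hψ0 : ψ ≠ 0) (hψ'0 : ψ' ≠ 0)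
    (hψ : (laxL l x (lam l h₁ h₂)).mulVec ψ = eta l h₁ h₂ • ψ)
    (hψ' : (laxL l x (lam l h₁ h₂)).mulVec ψ' = eta l h₁ h₂ • ψ') :
    ∃ f : FunField l h₁ h₂, f ≠ 0 ∧ ψ' = f • ψ := by
  have h0 : ψ 0 ≠ 0 := fun h => hψ0 (eq_zero_of_apply_zero_eq_zero hψ h)
  have h0' : ψ' 0 ≠ 0 := fun h => hψ'0 (eq_zero_of_apply_zero_eq_zero hψ' h)
  refine ⟨ψ' 0 / ψ 0, div_ne_zero h0' h0, sub_eq_zero.1 ?_⟩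
  refine eq_zero_of_apply_zero_eq_zero (x := x) ?_ (by simp [h0])
  rw [Matrix.mulVec_sub, Matrix.mulVec_smul, hψ, hψ', smul_sub, smul_comm]

theorem HasCoords.exists_res (hP : HasCoords P a b) (hb : 3 * b ^ 2 - l ^ 2 ≠ 0)
    {f : FunField l h₁ h₂} (hf : P.v f ≤ 1) : ∃ c, P.Res f c := by
  rcases eq_or_ne f 0 with rfl | hf0
  · exact ⟨0, Place.res_zero_iff.2 (by simp)⟩
  obtain ⟨n, u, c, hc, hu, rfl⟩ := hP.exists_eq_zpow_mul hb hf0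
  have hn : 0 ≤ n := by
    rwa [map_mul, (hu P hP).v_eq_one hc, mul_one, map_zpow₀, hP.v_lam_sub hb, ← exp_zsmul,
      ← exp_zero, exp_le_exp, smul_eq_mul, mul_neg_one, Left.neg_nonpos_iff] at hf
  lift n to ℕ using hn
  rw [zpow_natCast]
  exact ⟨_, ((hP.res_lam.sub (P.res_algebraMap a)).pow n).mul (hu P hP)⟩

theorem HasCoords.mulVec_eq_smul_of_res {u : Fin 3 → ℂ} (hP : HasCoords P a b)
    (hu : ∀ i, P.Res (ψ i) (u i)) (hψ : (laxL l x (lam l h₁ h₂)).mulVec ψ = eta l h₁ h₂ • ψ) :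
    (laxL l x a).mulVec u = b • u := by
  have hL := hP.res_lam.map_aeval_mulVec hu (laxL l x (X : ℂ[X]))
  rw [← laxL_map, ← laxL_map, aeval_X, aeval_X, hψ] at hL
  exact funext fun i => (hL i).eq (hP.res_eta.mul (hu i))

theorem HasCoords.exists_res_smul_eigenvector (hP : HasCoords P a b)
    (hb : 3 * b ^ 2 - l ^ 2 ≠ 0) (hψ0 : ψ ≠ 0)
    (hψ : (laxL l x (lam l h₁ h₂)).mulVec ψ = eta l h₁ h₂ • ψ) :
    ∃ (c : FunField l h₁ h₂) (u : Fin 3 → ℂ), c ≠ 0 ∧ u ≠ 0 ∧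
      (∀ i, P.Res ((c • ψ) i) (u i)) ∧ (laxL l x a).mulVec u = b • u := by
  obtain ⟨c, hc, hmax⟩ := exists_maxVal_smul_eq_one P.v hψ0
  choose u hu using fun i => hP.exists_res hb (hmax ▸ le_maxVal (c • ψ) i)
  refine ⟨c, u, hc, ?_, hu, hP.mulVec_eq_smul_of_res hu ?_⟩
  · rintro rfl
    exact (maxVal_lt_one_of_res hu).ne hmax
  · rw [Matrix.mulVec_smul, hψ, smul_comm]

end Eigenvectors

section LocalShift

theorem map_laxDual_vecMul_laxL {R : Type*} [CommRing R] [Algebra ℂ R] {l μ ε : ℂ} {x : Phase}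
    {y : Fin 3 → ℂ} (hy : (laxL l x μ).mulVec y = ε • y) :
    Matrix.vecMul (algebraMap ℂ R ∘ laxDual μ y) (laxL l x (-algebraMap ℂ R μ)) =
      -algebraMap ℂ R ε • (algebraMap ℂ R ∘ laxDual μ y) := by
  have hL : laxL l x (-algebraMap ℂ R μ) = (laxL l x (-μ)).map (algebraMap ℂ R) := by
    rw [← map_neg]
    exact laxL_map l x (-μ) (Algebra.ofId ℂ R)
  ext i
  rw [hL, ← RingHom.map_vecMul, vecMul_laxDual_of_eigenvector hy]
  simp

variable {l h₁ h₂ μ ε a b : ℂ} {P : Place (FunField l h₁ h₂)} {x : Phase} {y u : Fin 3 → ℂ}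
  {ψ : Fin 3 → FunField l h₁ h₂}

theorem exists_res_dotProduct_div (hy : (laxL l x μ).mulVec y = ε • y)
    (hψ : (laxL l x (lam l h₁ h₂)).mulVec ψ = eta l h₁ h₂ • ψ) (hP : HasCoords P a b)
    (hu : ∀ i, P.Res (ψ i) (u i)) (hne : a + μ ≠ 0 ∨ b + ε ≠ 0) :
    ∃ (c : FunField l h₁ h₂) (c₀ : ℂ), P.Res c c₀ ∧
      c * (lam l h₁ h₂ + algebraMap ℂ _ μ) = 2 * ((algebraMap ℂ _ ∘ laxDual μ y) ⬝ᵥ ψ) ∧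
      c₀ * (a + μ) = 2 * (laxDual μ y ⬝ᵥ u) ∧
      c₀ * (b + ε) = 2 * (laxDual μ y ⬝ᵥ (laxSlope x (a - μ)).mulVec u) := by
  set r := lam l h₁ h₂ + algebraMap ℂ _ μ
  set s := eta l h₁ h₂ + algebraMap ℂ _ ε
  set w : Fin 3 → FunField l h₁ h₂ := algebraMap ℂ _ ∘ laxDual μ y
  set S := laxSlope x (lam l h₁ h₂ - algebraMap ℂ _ μ)
  have hr : r ≠ 0 := by simpa [r] using lam_sub_ne_zero (l := l) (h₁ := h₁) (h₂ := h₂) (-μ)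
  have hcr : 2 * (w ⬝ᵥ ψ) / r * r = 2 * (w ⬝ᵥ ψ) := div_mul_cancel₀ _ hr
  have hcs : 2 * (w ⬝ᵥ ψ) / r * s = 2 * (w ⬝ᵥ S.mulVec ψ) := by
    field_simp
    linear_combination 2 * add_mul_dotProduct_eq (map_laxDual_vecMul_laxL hy) hψ
  set c := 2 * (w ⬝ᵥ ψ) / r
  have hres {φ : Fin 3 → FunField l h₁ h₂} {z : Fin 3 → ℂ} (h : ∀ i, P.Res (φ i) (z i)) :
      P.Res (2 * (w ⬝ᵥ φ)) (2 * (laxDual μ y ⬝ᵥ z)) := by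
    rw [← map_ofNat (algebraMap ℂ (FunField l h₁ h₂)) 2]
    exact (Place.Res.dotProduct (fun i => P.res_algebraMap _) h).const_mul 2
  have hS (i) : P.Res (S.mulVec ψ i) ((laxSlope x (a - μ)).mulVec u i) := by
    have h := (hP.res_lam.sub (P.res_algebraMap μ)).map_aeval_mulVec hu (laxSlope x (X : ℂ[X])) i
    rwa [← laxSlope_map, ← laxSlope_map, aeval_X, aeval_X] at h
  have hr_res : P.Res r (a + μ) := hP.res_lam.add (P.res_algebraMap μ)
  have hs_res : P.Res s (b + ε) := hP.res_eta.add (P.res_algebraMap ε)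
  obtain ⟨c₀, hc⟩ : ∃ c₀, P.Res c c₀ := by
    rcases hne with h | h
    · exact ⟨_, Place.Res.of_mul (hcr ▸ hres hu) hr_res h⟩
    · exact ⟨_, Place.Res.of_mul (hcs ▸ hres hS) hs_res h⟩
  exact ⟨c, c₀, hc, hcr, (hc.mul hr_res).eq (hcr ▸ hres hu), (hc.mul hs_res).eq (hcs ▸ hres hS)⟩

theorem maxVal_laxDarboux_mulVec_of_ne (hy : (laxL l x μ).mulVec y = ε • y) (hy₀ : y 0 = 1)
    (hψ : (laxL l x (lam l h₁ h₂)).mulVec ψ = eta l h₁ h₂ • ψ) (hP : HasCoords P a b)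
    (hu : ∀ i, P.Res (ψ i) (u i)) (hu₀ : u ≠ 0) (hne : ¬(μ = a ∧ ε = b))
    (hne' : ¬(-μ = a ∧ -ε = b)) :
    maxVal P.v ((laxDarboux μ y (lam l h₁ h₂)).mulVec ψ) =
      P.v (lam l h₁ h₂ + algebraMap ℂ _ μ) := by
  have hne'' : a + μ ≠ 0 ∨ b + ε ≠ 0 := by
    contrapose! hne'
    exact ⟨by linear_combination -hne'.1, by linear_combination -hne'.2⟩
  obtain ⟨c, c₀, hc, hcr, ha, hb⟩ := exists_res_dotProduct_div hy hψ hP hu hne''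
  refine maxVal_darboux_mulVec_of_ne hu hc hcr fun huy => hne ?_
  subst huy
  have hc₀ : c₀ ≠ 0 := left_ne_zero_of_smul hu₀
  rw [dotProduct_smul, laxDual_dotProduct_self, hy₀, smul_eq_mul] at ha
  have haμ : a = μ := mul_left_cancel₀ hc₀ (by linear_combination ha)
  rw [haμ, sub_self, Matrix.mulVec_smul, dotProduct_smul, laxDual_dotProduct_laxSlope_mulVec l,
    hy, Pi.smul_apply, hy₀, smul_eq_mul, smul_eq_mul] at hb
  exact ⟨haμ.symm, mul_left_cancel₀ hc₀ (by linear_combination -hb)⟩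

theorem two_mul_laxDual_dotProduct_sub {R : Type*} [CommRing R] [Algebra ℂ R] (hy₀ : y 0 = 1)
    (t : R) :
    2 * ((algebraMap ℂ R ∘ laxDual μ y) ⬝ᵥ (algebraMap ℂ R ∘ y)) - (t + algebraMap ℂ R μ) =
      algebraMap ℂ R μ - t := by
  rw [← RingHom.map_dotProduct, laxDual_dotProduct_self, hy₀]
  simp only [one_pow, mul_one]
  ring

theorem maxVal_laxDarboux_mulVec_of_eq (hy : (laxL l x μ).mulVec y = ε • y) (hy₀ : y 0 = 1)
    (hψ : (laxL l x (lam l h₁ h₂)).mulVec ψ = eta l h₁ h₂ • ψ) (hP : HasCoords P μ ε)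
    (hε : 3 * ε ^ 2 - l ^ 2 ≠ 0) {k : ℂ} (hk : k ≠ 0) (hu : ∀ i, P.Res (ψ i) ((k • y) i))
    (hne : μ + μ ≠ 0 ∨ ε + ε ≠ 0) :
    maxVal P.v ((laxDarboux μ y (lam l h₁ h₂)).mulVec ψ) =
      P.v (lam l h₁ h₂ + algebraMap ℂ _ μ) * exp (-1) := by
  obtain ⟨c, c₀, hc, hcr, ha, hb⟩ := exists_res_dotProduct_div hy hψ hP hu hne
  rw [dotProduct_smul, laxDual_dotProduct_self, hy₀, smul_eq_mul] at ha
  rw [sub_self, Matrix.mulVec_smul, dotProduct_smul, laxDual_dotProduct_laxSlope_mulVec l,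
    hy, Pi.smul_apply, hy₀, smul_eq_mul, smul_eq_mul] at hb
  have hc₀ : c₀ = k := by
    rcases hne with h | h
    · exact mul_right_cancel₀ h (by linear_combination ha)
    · exact mul_right_cancel₀ h (by linear_combination hb)
  refine (maxVal_darboux_mulVec_le_of_eq hu hc hcr (by rw [hc₀])).antisymm ?_
  have hψ1 : maxVal P.v ψ = 1 := maxVal_eq_one_of_res hu
    (smul_ne_zero hk fun h => by simp [h] at hy₀)
  have hv : P.v (algebraMap ℂ _ μ - lam l h₁ h₂) = exp (-1) := by
    rw [Valuation.map_sub_swap, hP.v_lam_sub hε]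
  have hv_le : P.v (algebraMap ℂ _ μ - lam l h₁ h₂) ≤ 1 := by
    rw [Valuation.map_sub_swap]
    exact hP.res_lam.le
  have h := le_maxVal_darboux_mulVec (v := P.v) (y := algebraMap ℂ _ ∘ y)
    (w := algebraMap ℂ _ ∘ laxDual μ y) (fun i => P.v_algebraMap_le_one _)
    (fun i => P.v_algebraMap_le_one _) (lam l h₁ h₂ + algebraMap ℂ _ μ) ψ
  rwa [two_mul_laxDual_dotProduct_sub hy₀, max_eq_left hv_le, hv, hψ1, mul_one, one_mul,
    mul_comm] at h

theorem maxVal_laxDarboux_mulVec_of_one_le (hy₀ : y 0 = 1)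
    (h : 1 ≤ P.v (lam l h₁ h₂ - algebraMap ℂ _ μ)) (h' : 1 ≤ P.v (lam l h₁ h₂ + algebraMap ℂ _ μ))
    (ψ : Fin 3 → FunField l h₁ h₂) :
    maxVal P.v ((laxDarboux μ y (lam l h₁ h₂)).mulVec ψ) =
      P.v (lam l h₁ h₂ + algebraMap ℂ _ μ) * maxVal P.v ψ := by
  refine maxVal_darboux_mulVec_of_one_le (y := algebraMap ℂ _ ∘ y)
    (w := algebraMap ℂ _ ∘ laxDual μ y) (fun i => P.v_algebraMap_le_one _)
    (fun i => P.v_algebraMap_le_one _) h' ?_ ψ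
  rwa [two_mul_laxDual_dotProduct_sub hy₀, Valuation.map_sub_swap]

end LocalShift

section GlobalShift

variable {l h₁ h₂ μ ε a b : ℂ} {e : Fin 3 → ℂ} {α : Fin 3} {x : Phase} {y u : Fin 3 → ℂ}
  {ψ : Fin 3 → FunField l h₁ h₂} {P : Place (FunField l h₁ h₂)}
  {Q : Fin 3 → Place (FunField l h₁ h₂)}

theorem eq_zero_of_laxDual_eq_zero (hy : (laxL l x μ).mulVec y = ε • y) (hy₀ : y 0 = 1)
    (hw : laxDual μ y = 0) : μ = 0 ∧ ε = 0 := by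
  constructor
  · simpa [hw, hy₀] using (laxDual_dotProduct_self μ y).symm
  · simpa [hw, hy, hy₀] using (laxDual_dotProduct_laxSlope_mulVec l x μ y).symm

theorem laxDual_dotProduct_ne_zero (he : Function.Injective e)
    (hL : ∀ i, ∃ v ≠ 0, (laxL l x (-μ)).mulVec v = -e i • v)
    (hy : (laxL l x μ).mulVec y = e α • y) (hw : laxDual μ y ≠ 0) (hu₀ : u ≠ 0)
    (hu : (laxL l x (-μ)).mulVec u = -e α • u) : laxDual μ y ⬝ᵥ u ≠ 0 :=
  dotProduct_ne_zero_of_eigenvectors (neg_injective.comp he) hL hu₀ hu hw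
    (vecMul_laxDual_of_eigenvector hy)

theorem not_eq_neg_of_laxDual_ne_zero (he : Function.Injective e)
    (hL : ∀ i, ∃ v ≠ 0, (laxL l x (-μ)).mulVec v = -e i • v)
    (hy : (laxL l x μ).mulVec y = e α • y) (hy₀ : y 0 = 1) (hw : laxDual μ y ≠ 0) :
    ¬(μ = -μ ∧ e α = -e α) := by
  rintro ⟨hμ, hα⟩
  have h := laxDual_dotProduct_ne_zero he hL hy hw (u := y) (fun h => by simp [h] at hy₀)
    (by rw [← hμ, ← hα, hy])
  rw [laxDual_dotProduct_self] at h
  exact h (by rw [self_eq_neg.1 hμ, zero_mul])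

variable (he : Function.Injective e) (hQ : ∀ i, HasCoords (Q i) μ (e i))
include he hQ

theorem exists_eigenvector_of_fibre (hψ₀ : ψ ≠ 0)
    (hψ : (laxL l x (lam l h₁ h₂)).mulVec ψ = eta l h₁ h₂ • ψ) (i : Fin 3) :
    ∃ v ≠ 0, (laxL l x μ).mulVec v = e i • v := by
  obtain ⟨-, v, -, hv₀, -, hv⟩ := (hQ i).exists_res_smul_eigenvector
    (deriv_ne_zero_of_onCurve (fun i => (hQ i).onCurve) he i) hψ₀ hψ
  exact ⟨v, hv₀, hv⟩

theorem maxVal_laxDarboux_mulVec_of_res (hy : (laxL l x μ).mulVec y = e α • y) (hy₀ : y 0 = 1)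
    (hw : laxDual μ y ≠ 0) (hψ : (laxL l x (lam l h₁ h₂)).mulVec ψ = eta l h₁ h₂ • ψ)
    (hP : HasCoords P a b) (hu : ∀ i, P.Res (ψ i) (u i)) (hu₀ : u ≠ 0) :
    maxVal P.v ((laxDarboux μ y (lam l h₁ h₂)).mulVec ψ) =
      P.v (lam l h₁ h₂ + algebraMap ℂ _ μ) *
        exp (pt ((Q α).map (upsilon l h₁ h₂)) P - pt (Q α) P) := by
  have hy_ne : y ≠ 0 := fun h => by simp [h] at hy₀
  have hψ₀ : ψ ≠ 0 := by
    rintro rfl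
    exact hu₀ (funext fun i => (hu i).eq (Place.res_zero_iff.2 (by simp)))
  have hυQ (i) := (hQ i).map_upsilon
  have hL := exists_eigenvector_of_fibre he hQ hψ₀ hψ
  have hL' := exists_eigenvector_of_fibre (neg_injective.comp he) hυQ hψ₀ hψ
  have hα := deriv_ne_zero_of_onCurve (fun i => (hQ i).onCurve) he α
  have hα' : 3 * (-e α) ^ 2 - l ^ 2 ≠ 0 := by rwa [neg_sq]
  have hne := not_eq_neg_of_laxDual_ne_zero he hL' hy hy₀ hw
  have hLu := hP.mulVec_eq_smul_of_res hu hψ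
  rw [pt_apply, pt_apply, (hQ α).eq_iff hP hα, (hυQ α).eq_iff hP hα']
  by_cases h : μ = a ∧ e α = b
  · obtain ⟨rfl, rfl⟩ := h
    obtain ⟨k, rfl⟩ := exists_eq_smul_of_mulVec_eq_smul he hL hy_ne hy hLu
    rw [maxVal_laxDarboux_mulVec_of_eq hy hy₀ hψ hP hα (left_ne_zero_of_smul hu₀) hu]
    · rw [if_neg fun h => hne ⟨h.1.symm, h.2.symm⟩, if_pos ⟨rfl, rfl⟩, zero_sub]
    · contrapose! hne
      exact ⟨eq_neg_of_add_eq_zero_left hne.1, eq_neg_of_add_eq_zero_left hne.2⟩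
  by_cases h' : -μ = a ∧ -e α = b
  · obtain ⟨rfl, rfl⟩ := h'
    have hr : P.Res (lam l h₁ h₂ + algebraMap ℂ _ μ) 0 := by
      simpa using hP.res_lam.add (P.res_algebraMap μ)
    have hvr := hP.v_lam_sub hα'
    rw [map_neg, sub_neg_eq_add] at hvr
    rw [laxDarboux, maxVal_darboux_mulVec_eq_one hu hr
      (laxDual_dotProduct_ne_zero he hL' hy hw hu₀ hLu) hy_ne, hvr, if_pos ⟨rfl, rfl⟩, if_neg h,
      ← exp_add]
    rfl
  · rw [maxVal_laxDarboux_mulVec_of_ne hy hy₀ hψ hP hu hu₀ h h', if_neg h, if_neg h', sub_zero,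
      exp_zero, mul_one]

theorem HasCoords.maxVal_laxDarboux_mulVec (hy : (laxL l x μ).mulVec y = e α • y) (hy₀ : y 0 = 1)
    (hw : laxDual μ y ≠ 0) (hψ₀ : ψ ≠ 0)
    (hψ : (laxL l x (lam l h₁ h₂)).mulVec ψ = eta l h₁ h₂ • ψ)
    (hP : HasCoords P a b) (hb : 3 * b ^ 2 - l ^ 2 ≠ 0) :
    maxVal P.v ((laxDarboux μ y (lam l h₁ h₂)).mulVec ψ) =
      P.v (lam l h₁ h₂ + algebraMap ℂ _ μ) *
        exp (pt ((Q α).map (upsilon l h₁ h₂)) P - pt (Q α) P) * maxVal P.v ψ := by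
  obtain ⟨c, u, hc, hu₀, hu, -⟩ := hP.exists_res_smul_eigenvector hb hψ₀ hψ
  have hcψ : (laxL l x (lam l h₁ h₂)).mulVec (c • ψ) = eta l h₁ h₂ • c • ψ := by
    rw [Matrix.mulVec_smul, hψ, smul_comm]
  have hval := maxVal_laxDarboux_mulVec_of_res he hQ hy hy₀ hw hcψ hP hu hu₀
  have hone := maxVal_eq_one_of_res hu hu₀
  rw [Matrix.mulVec_smul, maxVal_smul] at hval
  rw [maxVal_smul] at hone
  refine mul_left_cancel₀ ((map_ne_zero P.v).2 hc) ?_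
  rw [hval, mul_left_comm, hone, mul_one]

theorem maxVal_laxDarboux_mulVec (hy : (laxL l x μ).mulVec y = e α • y) (hy₀ : y 0 = 1)
    (hψ₀ : ψ ≠ 0) (hψ : (laxL l x (lam l h₁ h₂)).mulVec ψ = eta l h₁ h₂ • ψ)
    (P : Place (FunField l h₁ h₂)) :
    maxVal P.v ((laxDarboux μ y (lam l h₁ h₂)).mulVec ψ) =
      P.v (lam l h₁ h₂ + algebraMap ℂ _ μ) *
        exp (pt ((Q α).map (upsilon l h₁ h₂)) P - pt (Q α) P) * maxVal P.v ψ := by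
  have hυQ (i) := (hQ i).map_upsilon
  have hC (i) := (hQ i).onCurve
  have hC' (i) := (hυQ i).onCurve
  have he' : Function.Injective (-e ·) := neg_injective.comp he
  rcases eq_or_ne (laxDual μ y) 0 with hw | hw
  · obtain ⟨hμ, hα⟩ := eq_zero_of_laxDual_eq_zero hy hy₀ hw
    have hfix : (Q α).map (upsilon l h₁ h₂) = Q α :=
      (((hQ α).eq_iff (hυQ α) (deriv_ne_zero_of_onCurve hC he α)).2 (by simp [hμ, hα])).symm
    have hΦ : (laxDarboux μ y (lam l h₁ h₂)).mulVec ψ =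
        (-(lam l h₁ h₂ + algebraMap ℂ _ μ)) • ψ := by
      rw [laxDarboux, darboux_mulVec, hw, Pi.comp_zero, map_zero, Function.const_zero,
        zero_dotProduct, mul_zero, zero_smul, zero_sub, neg_smul]
    rw [hΦ, maxVal_smul, Valuation.map_neg, hfix, sub_self, exp_zero, mul_one]
  by_cases h : P.Res (lam l h₁ h₂) μ
  · obtain ⟨i, hi⟩ := exists_hasCoords_of_res_lam hC he h
    exact hi.maxVal_laxDarboux_mulVec he hQ hy hy₀ hw hψ₀ hψ (deriv_ne_zero_of_onCurve hC he i)
  by_cases h' : P.Res (lam l h₁ h₂) (-μ)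
  · obtain ⟨i, hi⟩ := exists_hasCoords_of_res_lam hC' he' h'
    exact hi.maxVal_laxDarboux_mulVec he hQ hy hy₀ hw hψ₀ hψ (deriv_ne_zero_of_onCurve hC' he' i)
  rw [maxVal_laxDarboux_mulVec_of_one_le hy₀ (not_lt.1 h) (by simpa [Place.Res] using h'),
    pt_apply, pt_apply, if_neg, if_neg, sub_zero, exp_zero, mul_one]
  · rintro rfl
    exact h (hQ α).res_lam
  · rintro rfl
    exact h' (hυQ α).res_lam

end GlobalShift

section Divisors

theorem sum_eq_add_add_of_card_eq_three {ι M : Type*} [Fintype ι] [AddCommMonoid M] {i j k : ι}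
    (hι : Fintype.card ι = 3) (hij : i ≠ j) (hik : i ≠ k) (hjk : j ≠ k) (f : ι → M) :
    ∑ n, f n = f i + f j + f k := by
  classical
  have huniv : ({i, j, k} : Finset ι) = Finset.univ :=
    Finset.eq_univ_of_card _ (hι ▸ Finset.card_eq_three.2 ⟨i, j, k, hij, hik, hjk, rfl⟩)
  rw [← huniv, Finset.sum_insert (by simp [hij, hik]), Finset.sum_pair hjk, add_assoc]

variable {l h₁ h₂ μ : ℂ} {e : Fin 3 → ℂ} {α : Fin 3} {x x' : Phase}
  {Q : Fin 3 → Place (FunField l h₁ h₂)} {D D' : Divisor (FunField l h₁ h₂)}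

theorem linEquiv_sum_pt_fibre (he : Function.Injective e) (hQ : ∀ i, HasCoords (Q i) μ (e i))
    {infty : Place (FunField l h₁ h₂)} (h_infty : IsInfinity infty) :
    LinEquiv (∑ i, pt (Q i)) (3 • pt infty) := by
  have hC (i) := (hQ i).onCurve
  have hQ_inj : Function.Injective Q := fun i j h => he ((hQ i).res_eta.eq (h ▸ (hQ j).res_eta))
  refine ⟨lam l h₁ h₂ - algebraMap ℂ _ μ, lam_sub_ne_zero μ, fun P => ?_⟩
  simp only [Finsupp.sub_apply, Finsupp.finsetSum_apply, Finsupp.smul_apply, pt_apply]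
  by_cases hP : IsInfinity P
  · have hv : P.v (lam l h₁ h₂ - algebraMap ℂ _ μ) = exp 3 := by
      rw [P.v.map_sub_eq_of_lt_left ((P.v_algebraMap_le_one μ).trans_lt hP), hP.v_lam_eq_exp]
    have hPQ (i) : Q i ≠ P := fun h => hP.not_ge (h ▸ (hQ i).res_lam.v_le_one)
    simp [hv, hPQ, h_infty.eq_of_isInfinity hP]
  have hP_ne : infty ≠ P := fun h => hP (h ▸ h_infty)
  by_cases hres : P.Res (lam l h₁ h₂) μ
  · obtain ⟨i, hi⟩ := exists_hasCoords_of_res_lam hC he hres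
    obtain rfl := (hQ i).eq_of_hasCoords hi (deriv_ne_zero_of_onCurve hC he i)
    simp [hi.v_lam_sub (deriv_ne_zero_of_onCurve hC he i), hP_ne, hQ_inj.eq_iff]
  · have hv : P.v (lam l h₁ h₂ - algebraMap ℂ _ μ) = 1 :=
      le_antisymm (P.v.map_sub_le (not_lt.1 hP) (P.v_algebraMap_le_one μ)) (not_lt.1 hres)
    have hPQ (i) : Q i ≠ P := fun h => hres (h ▸ (hQ i).res_lam)
    simp [hv, hPQ, hP_ne]

theorem IsEigenvectorDivisor.linEquiv (hD : IsEigenvectorDivisor x D)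
    (hD' : IsEigenvectorDivisor x D') : LinEquiv D D' := by
  obtain ⟨ψ, hψ₀, hψ, hψD⟩ := hD
  obtain ⟨ψ', hψ₀', hψ', hψD'⟩ := hD'
  obtain ⟨f, hf, rfl⟩ := exists_eq_smul_of_eigenvectors hψ₀ hψ₀' hψ hψ'
  exact hψD.linEquiv hf hψD'

theorem IsEigenvectorDivisor.of_isBacklundImage (he : Function.Injective e)
    (hQ : ∀ i, HasCoords (Q i) μ (e i)) (hx : IsBacklundImage l μ (e α) x x')
    (hD : IsEigenvectorDivisor x D) :
    IsEigenvectorDivisor x' (D + (pt ((Q α).map (upsilon l h₁ h₂)) - pt (Q α))) := by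
  obtain ⟨Y₁, Y₂, hy, hM⟩ := hx
  obtain ⟨ψ, hψ₀, hψ, hψD⟩ := hD
  set y : Fin 3 → ℂ := ![1, Y₁, Y₂]
  set r := lam l h₁ h₂ + algebraMap ℂ _ μ
  have hr : r ≠ 0 := by simpa [r] using lam_sub_ne_zero (l := l) (h₁ := h₁) (h₂ := h₂) (-μ)
  have hpole : IsPoleDivisor (r⁻¹ • (intertwiner μ y (lam l h₁ h₂)).mulVec ψ)
      (D + (pt ((Q α).map (upsilon l h₁ h₂)) - pt (Q α))) := by
    refine isPoleDivisor_iff.2 fun P => ?_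
    rw [maxVal_smul, intertwiner, ← Matrix.mulVec_mulVec,
      maxVal_map_mulVec_of_isUnit (isUnit_gauge y),
      maxVal_laxDarboux_mulVec he hQ hy rfl hψ₀ hψ, isPoleDivisor_iff.1 hψD, map_inv₀, mul_assoc,
      inv_mul_cancel_left₀ ((map_ne_zero P.v).2 hr), ← exp_add, add_comm]
    rfl
  refine ⟨_, hpole.ne_zero (Q α), ?_, hpole⟩
  have hL := laxL_mul_intertwiner_of_forall
    (fun t => by simpa only [matM_eq_intertwiner] using hM t) (lam l h₁ h₂)
  rw [Matrix.mulVec_smul, Matrix.mulVec_mulVec, hL, ← Matrix.mulVec_mulVec, hψ,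
    Matrix.mulVec_smul, smul_comm]

theorem IsBacklundImage.linEquiv (he : Function.Injective e) (hQ : ∀ i, HasCoords (Q i) μ (e i))
    (hx : IsBacklundImage l μ (e α) x x') (hD : IsEigenvectorDivisor x D)
    (hD' : IsEigenvectorDivisor x' D') :
    LinEquiv (D' - D) (pt ((Q α).map (upsilon l h₁ h₂)) - pt (Q α)) := by
  have h := hD'.linEquiv (hD.of_isBacklundImage he hQ hx)
  rwa [LinEquiv, ← sub_sub] at h

end Divisors

end

end HenonHeiles

theorem proposition3 (l h₁ h₂ μ : ℂ)
    -- the three distinct points `Q i = (μ, e i)` of the curve over `λ = μ`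
    (e : Fin 3 → ℂ) (he : ∀ i, OnCurve l h₁ h₂ μ (e i)) (he_inj : Function.Injective e)
    (Q : Fin 3 → Place (FunField l h₁ h₂)) (hQ : ∀ i, HasCoords (Q i) μ (e i))
    (infty : Place (FunField l h₁ h₂)) (h_infty : IsInfinity infty)
    (α β γ : Fin 3) (hαβ : α ≠ β) (hαγ : α ≠ γ) (hβγ : β ≠ γ) :
    (∀ (x x' : Phase) (D D' : Divisor (FunField l h₁ h₂)),
      H₁ l x = h₁ → H₂ l x = h₂ → IsBacklundImage l μ (e α) x x' →
      IsEigenvectorDivisor x D → IsEigenvectorDivisor x' D' →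
        LinEquiv
          (D' + pt (Q α) + pt ((Q β).map (upsilon l h₁ h₂)) + pt ((Q γ).map (upsilon l h₁ h₂)))
          (D + 3 • pt infty) ∧
        LinEquiv (D' - D)
          (3 • pt infty - pt (Q α) - pt ((Q β).map (upsilon l h₁ h₂))
            - pt ((Q γ).map (upsilon l h₁ h₂))) ∧
        LinEquiv (D' - D) (pt ((Q α).map (upsilon l h₁ h₂)) - pt (Q α)) ∧
        cls (D' - D) ∈ Prym (upsilon l h₁ h₂)) ∧
    (∃ T ∈ Prym (upsilon l h₁ h₂),
      ∀ (x x' : Phase) (D D' : Divisor (FunField l h₁ h₂)),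
        H₁ l x = h₁ → H₂ l x = h₂ → IsBacklundImage l μ (e α) x x' →
        IsEigenvectorDivisor x D → IsEigenvectorDivisor x' D' →
          cls D' = cls D + T) := by
  have hQ' (i) := (hQ i).map_upsilon
  have hshift {x x' D D'} (hx : IsBacklundImage l μ (e α) x x') (hD : IsEigenvectorDivisor x D)
      (hD' : IsEigenvectorDivisor x' D') := hx.linEquiv he_inj hQ hD hD'
  have hfibre := linEquiv_sum_pt_fibre (neg_injective.comp he_inj) hQ' h_infty
  rw [sum_eq_add_add_of_card_eq_three (Fintype.card_fin 3) hαβ hαγ hβγ] at hfibre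
  have hPrym := cls_pt_map_sub_pt_mem_Prym (h_infty.map_upsilon.eq_of_isInfinity h_infty) (Q α)
  have hcls {x x' D D'} (hx : IsBacklundImage l μ (e α) x x') (hD : IsEigenvectorDivisor x D)
      (hD' : IsEigenvectorDivisor x' D') :
      cls (D' - D) = cls (pt ((Q α).map (upsilon l h₁ h₂)) - pt (Q α)) :=
    QuotientAddGroup.eq_iff_sub_mem.2 (hshift hx hD hD')
  refine ⟨fun x x' D D' _ _ hx hD hD' => ⟨?_, ?_, hshift hx hD hD', ?_⟩,
    _, hPrym, fun x x' D D' _ _ hx hD hD' => ?_⟩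
  · unfold LinEquiv
    convert add_mem (hshift hx hD hD') hfibre using 1
    abel
  · unfold LinEquiv
    convert add_mem (hshift hx hD hD') hfibre using 1
    abel
  · rwa [hcls hx hD hD']
  · rw [← hcls hx hD hD', cls, cls, cls, ← QuotientAddGroup.mk_add, add_sub_cancel]
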